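/- **Notation.** For a topological abelian group $G$, $\mathsf{Char}(G)$ is the group of continuous homomorphisms $G\to U(1)$, with pointwise multiplication as group operation, written $\oplus$. For a number field $K$ (a finite extension of $\mathbb Q$), $O_K$ is its ring of integers and $\mathbb A_K=K_\infty\times\mathbb A_K^{\rm fin}$ its adele ring. Here $K_\infty$ is the product of the archimedean completions of $K$, identified with the space of families $(z_\sigma)$ of complex numbers, indexed by the embeddings $\sigma:K\to\mathbb C$, with $z_{\bar\sigma}=\overline{z_\sigma}$; and $\mathrm{Tr}(z)=\sum_\sigma z_\sigma\in\mathbb R$ for $z \in K_\infty$. Put $$\hat{\mathbb S}_K=\mathbb A_K/K \quad\text{(adele class group)},\qquad \mathbb T_K=K_\infty/O_K .$$ Let $\hat O_K\subset\mathbb A_K^{\rm fin}$ be the subring of integral finite adeles. Since $\hat{\mathbb S}_K=(K_\infty\times\hat O_K)/O_K$, the first projection induces a homomorphism $p_K:\hat{\mathbb S}_K\to\mathbb T_K$. The inverse different is $\mathfrak d_K^{-1}=\{\alpha\in K:\mathrm{Tr}_{K/\mathbb Q}(\alpha O_K)\subset\mathbb Z\}\supset O_K$. For an embedding $K\to L$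 of number fields, the trace map $\mathbb A_L\to\mathbb A_K$ is given on $L_\infty$ by $w_\sigma=\sum_{\tau|_K=\sigma}z_\tau$, and on $\mathbb A_L^{\rm fin}$ it is the continuous extension of $\mathrm{Tr}_{L/K}:L\to K$. It maps $L$ to $K$ and induces trace maps $\hat{\mathsf{Tr}}_{L/K}:\hat{\mathbb S}_L\to\hat{\mathbb S}_K$ and $\mathbb T_L\to\mathbb T_K$, compatible with $p_L$ and $p_K$. Let $\phi^K$ be the character of $\hat{\mathbb S}_K$ obtained by composing $p_K$ with the character of $\mathbb T_K$ induced by $z\mapsto\exp(2\pi i\,\mathrm{Tr}(z))$ on $K_\infty$. For $\alpha\in K$ let $\phi^K_\alpha(z)=\phi^K(\alpha z)$ for $z \in \hat{\mathbb S}_K$. Let $\mathcal K$ be a field that is the union of a directed system of number fields $K_\lambda$ (for instance an infinite algebraic extension of $\mathbb Q$). Its proto adele class group and proto torus are the inverse limits along the trace maps $$\hat{\hat{\mathbb S}}_{\mathcal K}=\varprojlim\hat{\mathbb S}_{K_\lambda},\qquad \hat{\mathbb T}_{\mathcal K}=\varprojlim\mathbb T_{K_\lambda},$$ with the projection $\hat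 p:\hat{\hat{\mathbb S}}_{\mathcal K}\to\hat{\mathbb T}_{\mathcal K}$ induced by the maps $p_{K_\lambda}$. Put $\mathfrak d_{\mathcal K}^{-1}=\varinjlim\mathfrak d_K^{-1}=\bigcup_K\mathfrak d_K^{-1}\subset\mathcal K$, where $K$ runs over the subfields of $\mathcal K$ of finite degree over $\mathbb Q$, and let $O_{\mathcal K}$ be the ring of algebraic integers in $\mathcal K$. For $\alpha\in\mathcal K$, let $\phi^{\mathcal K}_\alpha$ be the composite of the projection $\hat{\hat{\mathbb S}}_{\mathcal K}\to\hat{\mathbb S}_{K_\lambda}$ with $\phi^{K_\lambda}_\alpha$, for any $\lambda$ with $\alpha\in K_\lambda$. **Theorem.** **(a)** Let $K$ be a number field. There is a second operation $\otimes$ on $\mathsf{Char}(\hat{\mathbb S}_K)$ which, together with $\oplus$, makes it a field, and such that $\alpha\mapsto\phi^K_\alpha$ is an isomorphism of fields $K\to\mathsf{Char}(\hat{\mathbb S}_K)$. On the image of $K_\infty$ in $\hat{\mathbb S}_K$ the character $\phi^K_\alpha$ is $z\mapsto\exp(2\pi i\,\mathrm{Tr}(\alpha z))$. The isomorphism is natural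 for the trace maps: for every embedding $K\to L$ of number fields, $\phi^L_\alpha=\phi^K_\alpha\circ\hat{\mathsf{Tr}}_{L/K}$ for all $\alpha\in K$. Moreover $\chi\mapsto\chi\circ p_K$ embeds $\mathsf{Char}(\mathbb T_K)$ in $\mathsf{Char}(\hat{\mathbb S}_K)$, and its image corresponds to $\mathfrak d_K^{-1}$, that is, $\phi^K_\alpha$ lies in it if and only if $\alpha\in\mathfrak d_K^{-1}$. In particular $\alpha\mapsto\phi_\alpha^K$ gives an embedding of $O_K$ in $\mathsf{Char}(\mathbb T_K)$ that is additive, takes multiplication to $\otimes$, and takes $1$ to the unit of $\otimes$. **(b)** Let $\mathcal K$ be the union of a directed system of number fields $K_\lambda$. There is a second operation $\otimes$ on $\mathsf{Char}(\hat{\hat{\mathbb S}}_{\mathcal K})$ which, together with $\oplus$, makes it a field, and such that $\alpha\mapsto\phi^{\mathcal K}_\alpha$ is an isomorphism of fields $\mathcal K\to\mathsf{Char}(\hat{\hat{\mathbb S}}_{\mathcal K})$. The isomorphism is natural for the trace maps: for each $\lambda$ and each $\alpha\in K_\lambda$, $\phi^{\mathcal K}_\alpha$ is the pull-back of $\phi^{K_\lambda}_\alpha$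 under the projection $\hat{\hat{\mathbb S}}_{\mathcal K}\to\hat{\mathbb S}_{K_\lambda}$; and for every embedding of $\mathcal K$ in another union $\mathcal K'=\bigcup_\mu K'_\mu$ of a directed system of number fields, there is a continuous homomorphism $\hat{\hat{\mathbb S}}_{\mathcal K'}\to\hat{\hat{\mathbb S}}_{\mathcal K}$ that is given at finite levels by the trace maps $\hat{\mathbb S}_{K'_\mu}\to\hat{\mathbb S}_{K_\lambda}$ (for $K_\lambda\subset K'_\mu$), and $\phi^{\mathcal K'}_\alpha$ is the pull-back of $\phi^{\mathcal K}_\alpha$ under it for all $\alpha\in\mathcal K$. Moreover $\chi\mapsto\chi\circ\hat p$ embeds $\mathsf{Char}(\hat{\mathbb T}_{\mathcal K})$ in $\mathsf{Char}(\hat{\hat{\mathbb S}}_{\mathcal K})$, and its image corresponds to $\mathfrak d_{\mathcal K}^{-1}$. In particular $\alpha\mapsto\phi^{\mathcal K}_\alpha$ gives an embedding of $O_{\mathcal K}$ in $\mathsf{Char}(\hat{\mathbb T}_{\mathcal K})$ that is additive, takes multiplication to $\otimes$, and takes $1$ to the unit of $\otimes$. -/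

import Mathlib

open NumberField IsDedekindDomain Filter Topology WithZero

namespace AdeleChar

section FiniteAdeles

variable {K : Type*} [Field K] [NumberField K]

theorem ball_mem_nhds (v : HeightOneSpectrum (𝓞 K)) (m : ℕ) :
    {x : v.adicCompletion K | Valued.v x ≤ exp (-(m : ℤ))} ∈ 𝓝 (0 : v.adicCompletion K) := by
  obtain ⟨y, hy⟩ := v.valuedAdicCompletion_surjective K (exp (-(m : ℤ)))
  have hy0 : (Valued.v (R := v.adicCompletion K)).restrict y ≠ 0 := by
    rw [Valuation.ne_zero_iff]
    rintro rfl
    rw [map_zero] at hy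
    exact exp_ne_zero hy.symm
  have h := (Valued.isOpen_closedBall (v.adicCompletion K) hy0).mem_nhds (x := 0) (by simp)
  refine mem_of_superset h fun x hx => ?_
  have := (Valuation.restrict_le_iff _).1 hx
  rwa [hy] at this

theorem exists_ball_subset (v : HeightOneSpectrum (𝓞 K)) {U : Set (v.adicCompletion K)}
    (hU : U ∈ 𝓝 (0 : v.adicCompletion K)) :
    ∃ m : ℕ, {x : v.adicCompletion K | Valued.v x ≤ exp (-(m : ℤ))} ⊆ U := by
  obtain ⟨γ, hγ⟩ := Valued.mem_nhds_zero.1 hU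
  have h0 : MonoidWithZeroHom.ValueGroup₀.embedding γ.1 ≠ 0 := by
    simp
  obtain ⟨m, hm, -⟩ := exists_exp_neg_natCast_lt_and_lt h0 h0
  refine ⟨m, fun x hx => hγ ?_⟩
  exact (Valuation.restrict_lt_iff_lt_embedding _).2 (lt_of_le_of_lt hx hm)

/-- Every finite adele is approximated by elements of `K`. -/
theorem exists_approx (a : FiniteAdeleRing (𝓞 K) K) (T : Set (HeightOneSpectrum (𝓞 K)))
    (hT : T.Finite) (m : ℕ) :
    ∃ x : K, ∀ v, Valued.v (a v - (x : v.adicCompletion K)) ≤ 1 ∧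
      (v ∈ T → Valued.v (a v - (x : v.adicCompletion K)) ≤ exp (-(m : ℤ))) := by
  classical
  -- denominators
  have hfin : {v : HeightOneSpectrum (𝓞 K) | ¬ (a v ∈ v.adicCompletionIntegers K)}.Finite := a.2
  have hpow : ∀ v : HeightOneSpectrum (𝓞 K), ∃ n : ℕ, Valued.v (a v) ≤ exp (n : ℤ) := by
    intro v
    by_cases h : Valued.v (a v) = 0
    · exact ⟨0, by simp [h]⟩
    · obtain ⟨k, hk, -⟩ := exists_exp_neg_natCast_lt_and_lt (inv_ne_zero h) (inv_ne_zero h)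
      refine ⟨k, ?_⟩
      rw [exp_neg] at hk
      exact le_of_lt ((inv_lt_inv₀ (by simp) (zero_lt_iff.2 h)).1 hk)
  choose n hn using hpow
  obtain ⟨d, hdI, hd0⟩ : ∃ d ∈ ∏ v ∈ hfin.toFinset, v.asIdeal ^ (n v), d ≠ (0 : 𝓞 K) := by
    apply Submodule.exists_mem_ne_zero_of_ne_bot
    rw [Ne, ← Ideal.zero_eq_bot, Finset.prod_eq_zero_iff]
    rintro ⟨v, -, hv⟩
    exact v.ne_bot (by simpa using eq_zero_of_pow_eq_zero hv)
  have hd0' : (d : K) ≠ 0 := by simpa using hd0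
  have hda : ∀ v : HeightOneSpectrum (𝓞 K), v.valuation K (d : K) * Valued.v (a v) ≤ 1 := by
    intro v
    by_cases h : a v ∈ v.adicCompletionIntegers K
    · exact mul_le_one' (v.valuation_le_one d) h
    · have hmem : d ∈ v.asIdeal ^ n v :=
        Ideal.le_of_dvd (Finset.dvd_prod_of_mem (fun v : HeightOneSpectrum (𝓞 K) => v.asIdeal ^ n v)
          (a := v) (by simpa using h)) hdI
      have h1 : v.valuation K (d : K) ≤ exp (-(n v : ℤ)) := by
        have := (v.intValuation_le_pow_iff_mem d (n v)).2 hmem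
        rwa [← v.valuation_of_algebraMap (K := K)] at this
      calc _ ≤ exp (-(n v : ℤ)) * exp (n v : ℤ) := mul_le_mul' h1 (hn v)
        _ = 1 := by rw [← exp_add]; simp
  -- the finite set of places at which something has to be done
  have hdfin : {v : HeightOneSpectrum (𝓞 K) | v.valuation K (d : K) < 1}.Finite := by
    have : {v : HeightOneSpectrum (𝓞 K) | v.asIdeal ∣ Ideal.span {d}}.Finite :=
      Ideal.finite_factors (by simpa using hd0)
    refine this.subset fun v hv => ?_
    exact (v.valuation_lt_one_iff_dvd d).1 hv
  let S := (hdfin.union hT).toFinset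
  have hexp : ∀ v : HeightOneSpectrum (𝓞 K), ∃ e : ℕ,
      exp (-(e : ℤ)) ≤ exp (-(m : ℤ)) * v.valuation K (d : K) := by
    intro v
    have h0 : exp (-(m : ℤ)) * v.valuation K (d : K) ≠ 0 := by simp [hd0]
    obtain ⟨k, hk, -⟩ := exists_exp_neg_natCast_lt_and_lt h0 h0
    exact ⟨k, hk.le⟩
  choose e he using hexp
  have hloc : ∀ v : HeightOneSpectrum (𝓞 K), ∃ r : 𝓞 K,
      Valued.v ((d : K) * a v - ((r : K) : v.adicCompletion K)) ≤ exp (-(e v : ℤ)) := by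
    intro v
    have hcont : Tendsto (fun y : v.adicCompletion K => ((d : K) : v.adicCompletion K) * a v - y)
        (𝓝 (((d : K) : v.adicCompletion K) * a v)) (𝓝 0) := by
      have : Continuous (fun y : v.adicCompletion K =>
        ((d : K) : v.adicCompletion K) * a v - y) := by fun_prop
      simpa using this.tendsto (((d : K) : v.adicCompletion K) * a v)
    obtain ⟨x, hx⟩ := (v.denseRange_algebraMap K).exists_mem_open isOpen_interior
      ⟨_, mem_interior_iff_mem_nhds.2 (hcont (ball_mem_nhds v (e v)))⟩
    have hx' : Valued.v (((d : K) : v.adicCompletion K) * a v - (x : v.adicCompletion K))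
      ≤ exp (-(e v : ℤ)) := by
      have := interior_subset hx
      exact this
    have hx1 : v.valuation K x ≤ 1 := by
      rw [← v.valuedAdicCompletion_eq_valuation']
      have : ((x : K) : v.adicCompletion K) = ((d : K) : v.adicCompletion K) * a v -
        (((d : K) : v.adicCompletion K) * a v - (x : v.adicCompletion K)) := by ring
      rw [this]
      refine (Valuation.map_sub _ _ _).trans (max_le ?_ (hx'.trans ?_))
      · rw [map_mul, v.valuedAdicCompletion_eq_valuation']; exact hda v
      · rw [← exp_zero, exp_le_exp]; simp
    obtain ⟨r, hr⟩ := v.exists_valuation_sub_lt_of_integer hx1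
      (Units.mk0 (exp (-(e v : ℤ))) (by simp))
    refine ⟨r, ?_⟩
    have : ((d : K) : v.adicCompletion K) * a v - ((r : K) : v.adicCompletion K) =
      (((d : K) : v.adicCompletion K) * a v - (x : v.adicCompletion K)) -
        (((r : K) - x : K) : v.adicCompletion K) := by
      rw [show (((r : K) - x : K) : v.adicCompletion K) = (r : K) - (x : v.adicCompletion K) from
        map_sub (algebraMap K (v.adicCompletion K)) _ _]
      ring
    rw [this]
    refine (Valuation.map_sub _ _ _).trans (max_le hx' ?_)
    rw [v.valuedAdicCompletion_eq_valuation']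
    exact hr.le
  choose r hr using hloc
  obtain ⟨y, hy⟩ := exists_forall_sub_mem_ideal (s := S)
    (fun v : HeightOneSpectrum (𝓞 K) => v.asIdeal) e
    (fun v _ => v.prime) (fun v _ w _ hvw h => hvw (HeightOneSpectrum.ext h)) (fun v => r v)
  have hyS : ∀ v ∈ S, Valued.v ((d : K) * a v - ((y : K) : v.adicCompletion K))
      ≤ exp (-(e v : ℤ)) := by
    intro v hv
    have h1 := hy v hv
    rw [← v.intValuation_le_pow_iff_mem, ← v.valuation_of_algebraMap (K := K)] at h1
    have : ((d : K) : v.adicCompletion K) * a v - ((y : K) : v.adicCompletion K) =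
      (((d : K) : v.adicCompletion K) * a v - ((r v : K) : v.adicCompletion K)) -
        ((algebraMap (𝓞 K) K (y - r v) : K) : v.adicCompletion K) := by
      rw [show ((algebraMap (𝓞 K) K (y - r v) : K) : v.adicCompletion K) =
        (y : K) - ((r v : K) : v.adicCompletion K) by
          rw [map_sub]; exact map_sub (algebraMap K (v.adicCompletion K)) _ _]
      ring
    rw [this]
    refine (Valuation.map_sub _ _ _).trans (max_le (hr v) ?_)
    rwa [v.valuedAdicCompletion_eq_valuation']
  have hdv : ∀ v : HeightOneSpectrum (𝓞 K), ((d : K) : v.adicCompletion K) ≠ 0 := fun v =>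
    (map_ne_zero (algebraMap K (v.adicCompletion K))).2 hd0'
  obtain ⟨q, hq⟩ : ∃ q : K, q = algebraMap (𝓞 K) K y / algebraMap (𝓞 K) K d := ⟨_, rfl⟩
  have key : ∀ v : HeightOneSpectrum (𝓞 K),
      Valued.v (a v - (q : v.adicCompletion K)) =
      Valued.v ((d : K) * a v - ((y : K) : v.adicCompletion K)) / v.valuation K (d : K) := by
    intro v
    rw [← v.valuedAdicCompletion_eq_valuation', ← map_div₀]
    congr 1
    rw [show (q : v.adicCompletion K) = (y : K) / ((d : K) : v.adicCompletion K) from by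
        rw [hq]; exact map_div₀ (algebraMap K (v.adicCompletion K)) _ _]
    have := hdv v
    field_simp
  have hS : ∀ v ∈ S, Valued.v (a v - (q : v.adicCompletion K)) ≤
      exp (-(m : ℤ)) := by
    intro v hv
    rw [key]
    have h0 : 0 < v.valuation K (d : K) := zero_lt_iff.2 (by simp [hd0])
    rw [div_le_iff₀ h0]
    exact (hyS v hv).trans (he v)
  refine ⟨q, fun v => ⟨?_, fun hv => hS v (by simp [S, hv])⟩⟩
  by_cases hv : v ∈ S
  · refine (hS v hv).trans ?_
    rw [← exp_zero, exp_le_exp]; simp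
  · have h1 : v.valuation K (d : K) = 1 := by
      refine le_antisymm (v.valuation_le_one d) (not_lt.1 fun h => hv ?_)
      simp only [S, Set.Finite.mem_toFinset]
      exact Or.inl h
    rw [key, h1, div_one]
    refine (Valuation.map_sub _ _ _).trans (max_le ?_ ?_)
    · rw [map_mul, v.valuedAdicCompletion_eq_valuation']; exact hda v
    · rw [v.valuedAdicCompletion_eq_valuation']; exact v.valuation_le_one y

theorem exists_box_subset {U : Set (FiniteAdeleRing (𝓞 K) K)}
    (hU : U ∈ 𝓝 (0 : FiniteAdeleRing (𝓞 K) K)) :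
    ∃ (T : Set (HeightOneSpectrum (𝓞 K))) (m : ℕ), T.Finite ∧
      ∀ b : FiniteAdeleRing (𝓞 K) K,
        (∀ v, Valued.v (b v) ≤ 1 ∧ (v ∈ T → Valued.v (b v) ≤ exp (-(m : ℤ)))) → b ∈ U := by
  let φ : (∀ v : HeightOneSpectrum (𝓞 K),
      (v.adicCompletionIntegers K : Set (v.adicCompletion K))) → FiniteAdeleRing (𝓞 K) K :=
    RestrictedProduct.structureMap (fun v : HeightOneSpectrum (𝓞 K) => v.adicCompletion K)
      (fun v => (v.adicCompletionIntegers K : Set (v.adicCompletion K))) cofinite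
  have hφ : Continuous φ := RestrictedProduct.isEmbedding_structureMap.continuous
  have hU' : φ ⁻¹' U ∈ 𝓝 (fun v => ⟨0, zero_mem (v.adicCompletionIntegers K)⟩) :=
    hφ.continuousAt.preimage_mem_nhds hU
  rw [nhds_pi, Filter.mem_pi] at hU'
  obtain ⟨T, hT, t, ht, hsub⟩ := hU'
  have hm : ∀ v : HeightOneSpectrum (𝓞 K), ∃ m : ℕ, ∀ x : v.adicCompletionIntegers K,
      Valued.v (x : v.adicCompletion K) ≤ exp (-(m : ℤ)) → x ∈ t v := by
    intro v
    have h1 := ht v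
    rw [nhds_subtype_eq_comap, Filter.mem_comap] at h1
    obtain ⟨u, hu, hut⟩ := h1
    obtain ⟨m, hm⟩ := exists_ball_subset v hu
    exact ⟨m, fun x hx => hut (hm hx)⟩
  choose m hm using hm
  obtain ⟨M, hM⟩ := (hT.image m).bddAbove
  refine ⟨T, M, hT, fun b hb => ?_⟩
  let c : ∀ v : HeightOneSpectrum (𝓞 K),
      (v.adicCompletionIntegers K : Set (v.adicCompletion K)) := fun v => ⟨b v, (hb v).1⟩
  have hc : c ∈ T.pi t := by
    intro v hv
    refine hm v _ (((hb v).2 hv).trans ?_)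
    rw [exp_le_exp]
    have := hM ⟨v, hv, rfl⟩
    omega
  exact hsub hc

theorem denseRange_finiteAdele :
    DenseRange (algebraMap K (FiniteAdeleRing (𝓞 K) K)) := by
  intro a
  rw [mem_closure_iff_nhds]
  intro V hV
  have hcont : Tendsto (fun c : FiniteAdeleRing (𝓞 K) K => a - c) (𝓝 0) (𝓝 a) := by
    have : Continuous (fun c : FiniteAdeleRing (𝓞 K) K => a - c) := by fun_prop
    simpa using this.tendsto 0
  obtain ⟨T, m, hT, h⟩ := exists_box_subset (hcont hV)
  obtain ⟨x, hx⟩ := exists_approx a T hT m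
  refine ⟨algebraMap K _ x, ?_, x, rfl⟩
  have := h (a - algebraMap K _ x) hx
  simpa using this

variable (K) in
/-- The subgroup `Ô_K = ∏ O_v` of integral finite adeles. -/
def integralAdeles : AddSubgroup (FiniteAdeleRing (𝓞 K) K) where
  carrier := {a | ∀ v : HeightOneSpectrum (𝓞 K), a v ∈ v.adicCompletionIntegers K}
  zero_mem' _ := zero_mem _
  add_mem' ha hb v := add_mem (ha v) (hb v)
  neg_mem' ha _ := neg_mem (ha _)

theorem isOpen_integralAdeles :
    IsOpen (integralAdeles K : Set (FiniteAdeleRing (𝓞 K) K)) :=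
  RestrictedProduct.isOpen_forall_mem (R := fun v : HeightOneSpectrum (𝓞 K) => v.adicCompletion K)
    (A := fun v => (v.adicCompletionIntegers K : Set (v.adicCompletion K)))
    fun _ => Valued.isOpen_valuationSubring _

theorem exists_sub_mem_integralAdeles (a : FiniteAdeleRing (𝓞 K) K) :
    ∃ x : K, a - algebraMap K _ x ∈ integralAdeles K := by
  obtain ⟨x, hx⟩ := exists_approx a ∅ Set.finite_empty 0
  exact ⟨x, fun v => (hx v).1⟩

theorem algebraMap_mem_integralAdeles_iff (x : K) :
    algebraMap K (FiniteAdeleRing (𝓞 K) K) x ∈ integralAdeles K ↔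
      x ∈ (algebraMap (𝓞 K) K).range := by
  constructor
  · intro h
    refine HeightOneSpectrum.mem_integers_of_valuation_le_one K x fun v => ?_
    rw [← v.valuedAdicCompletion_eq_valuation']
    exact h v
  · rintro ⟨y, rfl⟩ v
    exact v.coe_algebraMap_mem (𝓞 K) K y

end FiniteAdeles

/-- A continuous additive map on a dense subgroup extends to the whole group. -/
theorem exists_continuous_extension {A B C : Type*} [AddCommGroup A] [AddCommGroup B]
    [TopologicalSpace B] [IsTopologicalAddGroup B] [AddCommGroup C] [UniformSpace C]
    [IsUniformAddGroup C] [CompleteSpace C] [T2Space C] (i : A →+ B) (hi : DenseRange i)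
    (f : A →+ C) (hf : ∀ U ∈ 𝓝 (0 : C), ∃ V ∈ 𝓝 (0 : B), ∀ x, i x ∈ V → f x ∈ U) :
    ∃ g : B →+ C, Continuous g ∧ ∀ x, g (i x) = f x := by
  let : UniformSpace B := IsTopologicalAddGroup.rightUniformSpace B
  have : IsUniformAddGroup B := isUniformAddGroup_of_addCommGroup
  let : UniformSpace A := UniformSpace.comap i inferInstance
  have hui : IsUniformInducing i := ⟨rfl⟩
  have : IsUniformAddGroup A := hui.isUniformAddGroup i
  have huf : UniformContinuous f := by
    refine uniformContinuous_of_continuousAt_zero f ?_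
    rw [ContinuousAt, map_zero]
    intro U hU
    obtain ⟨V, hV, hVU⟩ := hf U hU
    rw [hui.isInducing.nhds_eq_comap, map_zero]
    exact ⟨V, hV, fun x hx => hVU x hx⟩
  have hd := hui.isDenseInducing hi
  have hc : Continuous (hd.extend f) := (uniformContinuous_uniformly_extend hui hi huf).continuous
  have he : ∀ x, hd.extend f (i x) = f x := fun x => hd.extend_eq huf.continuous x
  refine ⟨AddMonoidHom.mk' (hd.extend f) fun x y => ?_, hc, he⟩
  refine hi.induction_on₂ ?_ (fun a b => ?_) x y
  · exact isClosed_eq (by fun_prop) (by fun_prop)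
  · rw [← map_add, he, he, he, map_add]

section FiniteTrace

/-- The trace `L → K` of the field extension given by an embedding `f : K → L`. -/
noncomputable def relTrace {K L : Type*} [Field K] [Field L] (f : K →+* L) : L →+ K :=
  letI := f.toAlgebra
  (Algebra.trace K L).toAddMonoidHom

theorem relTrace_mul {K L : Type*} [Field K] [Field L] (f : K →+* L) (c : K) (x : L) :
    relTrace f (f c * x) = c * relTrace f x := by
  let := f.toAlgebra
  have h : f c * x = c • x := (Algebra.smul_def c x).symm
  change Algebra.trace K L (f c * x) = c * Algebra.trace K L x
  rw [h, map_smul, smul_eq_mul]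

variable {K L : Type*} [Field K] [NumberField K] [Field L] [NumberField L]

theorem relTrace_integral (f : K →+* L) (x : L) (hx : x ∈ (algebraMap (𝓞 L) L).range) :
    relTrace f x ∈ (algebraMap (𝓞 K) K).range := by
  let := f.toAlgebra
  have : FiniteDimensional K L := Module.Finite.right ℚ K L
  obtain ⟨y, rfl⟩ := hx
  have h : IsIntegral ℤ (relTrace f (algebraMap (𝓞 L) L y)) :=
    Algebra.isIntegral_trace (L := K) (F := L) (NumberField.RingOfIntegers.isIntegral_coe y)
  exact ⟨⟨_, h⟩, rfl⟩

theorem exists_finiteTrace (f : K →+* L) :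
    ∃ T : FiniteAdeleRing (𝓞 L) L →ₜ+ FiniteAdeleRing (𝓞 K) K,
      (∀ x : L, T (algebraMap L _ x) = algebraMap K _ (relTrace f x)) ∧
      ∀ a ∈ integralAdeles L, T a ∈ integralAdeles K := by
  have hg : ∀ v : HeightOneSpectrum (𝓞 K), ∃ g : FiniteAdeleRing (𝓞 L) L →+ v.adicCompletion K,
      Continuous g ∧ ∀ x : L, g (algebraMap L _ x) =
        (algebraMap K (v.adicCompletion K)) (relTrace f x) := by
    intro v
    refine exists_continuous_extension
      (algebraMap L (FiniteAdeleRing (𝓞 L) L)).toAddMonoidHom denseRange_finiteAdele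
      ((algebraMap K (v.adicCompletion K)).toAddMonoidHom.comp (relTrace f)) fun U hU => ?_
    obtain ⟨m, hm⟩ := exists_ball_subset v hU
    obtain ⟨p, hp, hp0⟩ := Submodule.exists_mem_ne_zero_of_ne_bot
      (p := v.asIdeal ^ m) (by simpa using pow_ne_zero m v.ne_bot)
    have hc : (p : K) ≠ 0 := by simpa using hp0
    have hfc : f (p : K) ≠ 0 := by simpa using hc
    refine ⟨(fun a => algebraMap L (FiniteAdeleRing (𝓞 L) L) (f (p : K))⁻¹ * a) ⁻¹'
      (integralAdeles L), ?_, fun x hx => hm ?_⟩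
    · refine (isOpen_integralAdeles.preimage (by fun_prop)).mem_nhds ?_
      simp [zero_mem]
    · have hx' : algebraMap L (FiniteAdeleRing (𝓞 L) L) ((f (p : K))⁻¹ * x) ∈
          integralAdeles L := by rw [map_mul]; exact hx
      rw [algebraMap_mem_integralAdeles_iff] at hx'
      obtain ⟨y, hy⟩ := relTrace_integral f _ hx'
      have hxx : relTrace f x = (p : K) * (y : K) := by
        have hy' : (y : K) = relTrace f ((f (p : K))⁻¹ * x) := hy
        rw [hy', ← relTrace_mul, mul_inv_cancel_left₀ hfc]
      change Valued.v ((relTrace f x : K) : v.adicCompletion K) ≤ _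
      rw [v.valuedAdicCompletion_eq_valuation', hxx, map_mul]
      refine (mul_le_of_le_one_right' (v.valuation_le_one y)).trans ?_
      have := (v.intValuation_le_pow_iff_mem p m).2 hp
      rwa [← v.valuation_of_algebraMap (K := K)] at this
  choose g hgc hg using hg
  have hint : ∀ v, ∀ a ∈ integralAdeles L, g v a ∈ v.adicCompletionIntegers K := by
    intro v a ha
    have h1 : a ∈ closure ((integralAdeles L : Set (FiniteAdeleRing (𝓞 L) L)) ∩
        Set.range (algebraMap L (FiniteAdeleRing (𝓞 L) L))) :=
      denseRange_finiteAdele.open_subset_closure_inter isOpen_integralAdeles ha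
    have h2 : IsClosed (g v ⁻¹' (v.adicCompletionIntegers K : Set (v.adicCompletion K))) :=
      (Valued.isClosed_valuationSubring _).preimage (hgc v)
    refine closure_minimal ?_ h2 h1
    rintro _ ⟨hx, x, rfl⟩
    obtain ⟨y, hy⟩ := relTrace_integral f _ ((algebraMap_mem_integralAdeles_iff x).1 hx)
    change g v _ ∈ v.adicCompletionIntegers K
    rw [hg, ← hy]
    exact v.coe_algebraMap_mem (𝓞 K) K y
  have hres : ∀ a, ∀ᶠ v in cofinite, g v a ∈ v.adicCompletionIntegers K := by
    intro a
    obtain ⟨x, hx⟩ := exists_sub_mem_integralAdeles a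
    filter_upwards [(algebraMap K (FiniteAdeleRing (𝓞 K) K) (relTrace f x)).2] with v hv
    have : g v a = g v (a - algebraMap L _ x) + g v (algebraMap L _ x) := by
      rw [← map_add, sub_add_cancel]
    rw [this]
    refine add_mem (hint v _ hx) ?_
    rw [hg]
    exact hv
  let T : FiniteAdeleRing (𝓞 L) L →+ FiniteAdeleRing (𝓞 K) K :=
    AddMonoidHom.mk' (fun a => ⟨fun v => g v a, hres a⟩) fun a b =>
      FiniteAdeleRing.ext K fun v => map_add (g v) a b
  have hT : Continuous T := by
    refine continuous_of_continuousAt_zero T ?_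
    rw [ContinuousAt, map_zero]
    intro U hU
    obtain ⟨S, m, hS, h⟩ := exists_box_subset hU
    have hV : (integralAdeles L : Set (FiniteAdeleRing (𝓞 L) L)) ∩
        ⋂ v ∈ S, g v ⁻¹' {x | Valued.v x ≤ exp (-(m : ℤ))} ∈
          𝓝 (0 : FiniteAdeleRing (𝓞 L) L) := by
      refine inter_mem (isOpen_integralAdeles.mem_nhds (zero_mem _)) ?_
      rw [Filter.biInter_mem hS]
      intro v _
      refine (hgc v).continuousAt.preimage_mem_nhds ?_
      rw [map_zero]
      exact ball_mem_nhds v m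
    rw [Filter.mem_map]
    refine mem_of_superset hV fun a ha => h _ fun v => ⟨hint v a ha.1, fun hv => ?_⟩
    exact Set.mem_iInter₂.1 ha.2 v hv
  refine ⟨⟨T, hT⟩, fun x => FiniteAdeleRing.ext K fun v => hg v x, fun a ha v => hint v a ha⟩

end FiniteTrace

section InfiniteAdeles

open NumberField.InfinitePlace NumberField.InfinitePlace.Completion

variable {K : Type*} [Field K]

open scoped Classical in
/-- The coordinate `z_σ ∈ ℂ` of `z ∈ K_∞` at a complex embedding `σ` of `K`: the continuous
extension of `σ` from `K` to `K_∞`.  These coordinates identify `K_∞` with the space of families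
`(z_σ)` of complex numbers, indexed by the embeddings, that satisfy
`conj (z_σ) = z_(conj σ)`. -/
noncomputable def archCoord (σ : K →+* ℂ) : InfiniteAdeleRing K →+* ℂ :=
  if (mk σ).embedding = σ then
    (extensionEmbedding (mk σ)).comp (Pi.evalRingHom (fun v : InfinitePlace K => v.Completion) (mk σ))
  else
    (starRingEnd ℂ).comp ((extensionEmbedding (mk σ)).comp
      (Pi.evalRingHom (fun v : InfinitePlace K => v.Completion) (mk σ)))

theorem continuous_archCoord (σ : K →+* ℂ) : Continuous (archCoord σ) := by
  have h : Continuous fun z : InfiniteAdeleRing K => extensionEmbedding (mk σ) (z (mk σ)) :=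
    (isometry_extensionEmbedding _).continuous.comp (continuous_apply (mk σ))
  unfold archCoord
  split_ifs
  · exact h
  · exact Complex.continuous_conj.comp h

theorem archCoord_algebraMap (σ : K →+* ℂ) (x : K) : archCoord σ (algebraMap K _ x) = σ x := by
  have h : extensionEmbedding (mk σ) ((algebraMap K (InfiniteAdeleRing K) x) (mk σ)) =
      (mk σ).embedding x := extensionEmbedding_coe (mk σ) (WithAbs.toAbs _ x)
  unfold archCoord
  split_ifs with h1
  · change extensionEmbedding (mk σ) ((algebraMap K (InfiniteAdeleRing K) x) (mk σ)) = _
    rw [h, h1]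
  · change starRingEnd ℂ (extensionEmbedding (mk σ)
      ((algebraMap K (InfiniteAdeleRing K) x) (mk σ))) = _
    rw [h]
    have h2 : ComplexEmbedding.conjugate (mk σ).embedding = σ := by
      rcases embedding_mk_eq σ with h3 | h3
      · exact absurd h3 h1
      · rw [h3]; exact star_star σ
    exact RingHom.congr_fun h2 x

theorem archCoord_embedding [NumberField K] (v : InfinitePlace K) (z : InfiniteAdeleRing K) :
    archCoord v.embedding z = extensionEmbedding v (z v) := by
  refine (InfiniteAdeleRing.denseRange_algebraMap K).induction_on z ?_ fun x => ?_
  · exact isClosed_eq (continuous_archCoord _)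
      ((isometry_extensionEmbedding v).continuous.comp (continuous_apply v))
  · rw [archCoord_algebraMap]
    exact (extensionEmbedding_coe v (WithAbs.toAbs _ x)).symm

theorem archCoord_injective [NumberField K] {z w : InfiniteAdeleRing K}
    (h : ∀ σ : K →+* ℂ, archCoord σ z = archCoord σ w) : z = w := by
  funext v
  have := h v.embedding
  rw [archCoord_embedding, archCoord_embedding] at this
  exact (isometry_extensionEmbedding v).injective this

open scoped Classical in
theorem sum_embeddings_eq_relTrace {L : Type*} [Field L] [NumberField K] [NumberField L]
    (f : K →+* L) (σ : K →+* ℂ) (x : L) :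
    ∑ τ : L →+* ℂ with τ.comp f = σ, τ x = σ (relTrace f x) := by
  let := f.toAlgebra
  let := σ.toAlgebra
  have : FiniteDimensional K L := Module.Finite.right ℚ K L
  have h := trace_eq_sum_embeddings (K := K) (L := L) ℂ (x := x)
  have h' : σ (relTrace f x) = ∑ τ : L →ₐ[K] ℂ, τ x := h
  rw [h']
  symm
  refine Finset.sum_bij (fun τ _ => (τ : L →+* ℂ)) ?_ ?_ ?_ ?_
  · intro τ _
    simp only [Finset.mem_filter, Finset.mem_univ, true_and]
    exact RingHom.ext fun y => τ.commutes y
  · intro τ _ τ' _ h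
    exact AlgHom.coe_ringHom_injective h
  · intro τ hτ
    simp only [Finset.mem_filter, Finset.mem_univ, true_and] at hτ
    exact ⟨{ τ with commutes' := fun y => RingHom.congr_fun hτ y }, Finset.mem_univ _, rfl⟩
  · intro τ _
    rfl

open scoped Classical in
theorem exists_infiniteTrace {L : Type*} [Field L] [NumberField K] [NumberField L]
    (f : K →+* L) :
    ∃ T : InfiniteAdeleRing L →ₜ+ InfiniteAdeleRing K, ∀ (z : InfiniteAdeleRing L) (σ : K →+* ℂ),
      archCoord σ (T z) = ∑ τ : L →+* ℂ with τ.comp f = σ, archCoord τ z := by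
  have hS : ∀ σ : K →+* ℂ, Continuous fun z : InfiniteAdeleRing L =>
      ∑ τ : L →+* ℂ with τ.comp f = σ, archCoord τ z := fun σ =>
    continuous_finsetSum _ fun τ _ => continuous_archCoord τ
  have hex : ∀ (z : InfiniteAdeleRing L) (v : InfinitePlace K), ∃ w : v.Completion,
      extensionEmbedding v w =
        ∑ τ : L →+* ℂ with τ.comp f = v.embedding, archCoord τ z := by
    intro z v
    change _ ∈ Set.range (extensionEmbedding v)
    refine (InfiniteAdeleRing.denseRange_algebraMap L).induction_on
      (p := fun z => (∑ τ : L →+* ℂ with τ.comp f = v.embedding, archCoord τ z) ∈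
        Set.range (extensionEmbedding v)) z ?_ fun x => ?_
    · exact (isClosed_image_extensionEmbedding v).preimage (hS _)
    · refine ⟨(relTrace f x : K), ?_⟩
      simp_rw [archCoord_algebraMap]
      rw [sum_embeddings_eq_relTrace]
      exact extensionEmbedding_coe v (WithAbs.toAbs _ _)
  choose T hT using hex
  have hinj : ∀ v : InfinitePlace K, Function.Injective (extensionEmbedding v) :=
    fun v => (isometry_extensionEmbedding v).injective
  let T' : InfiniteAdeleRing L →+ InfiniteAdeleRing K := AddMonoidHom.mk' T fun z w => by
    funext v
    refine hinj v ?_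
    change _ = extensionEmbedding v (T z v + T w v)
    rw [map_add, hT, hT, hT, ← Finset.sum_add_distrib]
    simp_rw [map_add]
  have hTc : Continuous T' := by
    refine continuous_pi fun v => ?_
    rw [(isometry_extensionEmbedding v).isEmbedding.continuous_iff]
    refine (hS v.embedding).congr fun z => (hT z v).symm
  refine ⟨⟨T', hTc⟩, fun z σ => ?_⟩
  refine (InfiniteAdeleRing.denseRange_algebraMap L).induction_on z ?_ fun x => ?_
  · exact isClosed_eq ((continuous_archCoord σ).comp hTc) (hS σ)
  · have h : T (algebraMap L _ x) = algebraMap K (InfiniteAdeleRing K) (relTrace f x) := by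
      funext v
      refine hinj v ?_
      rw [hT]
      simp_rw [archCoord_algebraMap]
      rw [sum_embeddings_eq_relTrace]
      exact (extensionEmbedding_coe v (WithAbs.toAbs _ _)).symm
    change archCoord σ (T (algebraMap L _ x)) = _
    rw [h]
    simp_rw [archCoord_algebraMap]
    rw [sum_embeddings_eq_relTrace]

/-- The absolute trace `Tr : K_∞ → ℝ`, `Tr(z) = ∑_σ z_σ`, the sum over all complex embeddings. -/
noncomputable def absTrace (K : Type*) [Field K] [NumberField K] : InfiniteAdeleRing K →+ ℝ :=
  AddMonoidHom.mk' (fun z => (∑ σ : K →+* ℂ, archCoord σ z).re) fun z w => by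
    simp [Finset.sum_add_distrib]

theorem continuous_absTrace [NumberField K] : Continuous (absTrace K) :=
  Complex.continuous_re.comp (continuous_finsetSum _ fun σ _ => continuous_archCoord σ)

theorem absTrace_algebraMap [NumberField K] (x : K) :
    absTrace K (algebraMap K _ x) = (Algebra.trace ℚ K x : ℝ) := by
  have h := trace_eq_sum_embeddings (K := ℚ) (L := K) ℂ (x := x)
  have h2 : ∑ σ : K →+* ℂ, σ x = ∑ τ : K →ₐ[ℚ] ℂ, τ x :=
    Fintype.sum_equiv (RingHom.equivRatAlgHom K ℂ) _ _ fun _ => rfl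
  change (∑ σ : K →+* ℂ, archCoord σ (algebraMap K _ x)).re = _
  simp_rw [archCoord_algebraMap]
  rw [h2, ← h]
  simp

/-- The sum defining the absolute trace is real. -/
theorem absTrace_eq [NumberField K] (z : InfiniteAdeleRing K) :
    (absTrace K z : ℂ) = ∑ σ : K →+* ℂ, archCoord σ z := by
  refine (InfiniteAdeleRing.denseRange_algebraMap K).induction_on z ?_ fun x => ?_
  · exact isClosed_eq (Complex.continuous_ofReal.comp continuous_absTrace)
      (continuous_finsetSum _ fun σ _ => continuous_archCoord σ)
  · rw [absTrace_algebraMap]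
    have h := trace_eq_sum_embeddings (K := ℚ) (L := K) ℂ (x := x)
    have h2 : ∑ σ : K →+* ℂ, σ x = ∑ τ : K →ₐ[ℚ] ℂ, τ x :=
      Fintype.sum_equiv (RingHom.equivRatAlgHom K ℂ) _ _ fun _ => rfl
    simp_rw [archCoord_algebraMap]
    rw [h2, ← h]
    simp

end InfiniteAdeles

section AdeleClassGroup

/-- The character group of an abelian topological group: the continuous homomorphisms to the unit
circle.  Its operation, pointwise multiplication of values, is written additively. -/
abbrev CharGroup (G : Type*) [AddCommGroup G] [TopologicalSpace G] := G →ₜ+ Additive Circle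

/-- `otimes` is a multiplication that makes the abelian group `X` a field: there is a field
structure on `X` whose addition is that of `X` and whose multiplication is `otimes`. -/
def MakesField {X : Type*} [A : AddCommGroup X] (otimes : X → X → X) : Prop :=
  ∃ R : Field X, (∀ x y, R.add x y = A.add x y) ∧ ∀ x y, R.mul x y = otimes x y

/-- The value of a character as a complex number. -/
noncomputable def charVal {G : Type*} [AddCommGroup G] [TopologicalSpace G] (χ : CharGroup G)
    (g : G) : ℂ := ((χ g).toMul : Circle)

/-- The adele class group `Ŝ_K = 𝔸_K / K`. -/
abbrev AdeleClassGroup (K : Type*) [Field K] [NumberField K] :=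
  AdeleRing (𝓞 K) K ⧸ AdeleRing.principalSubgroup (𝓞 K) K

/-- The image of the ring of integers `O_K` in `K_∞`. -/
noncomputable def integerLattice (K : Type*) [Field K] : AddSubgroup (InfiniteAdeleRing K) :=
  ((algebraMap K (InfiniteAdeleRing K)).comp (algebraMap (𝓞 K) K)).range.toAddSubgroup

/-- The Minkowski torus `𝕋_K = K_∞ / O_K`. -/
abbrev MinkowskiTorus (K : Type*) [Field K] := InfiniteAdeleRing K ⧸ integerLattice K

/-- The adele with infinite component `z` and finite component `a`. -/
noncomputable def mkAdele {K : Type*} [Field K] [NumberField K] (z : InfiniteAdeleRing K)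
    (a : FiniteAdeleRing (𝓞 K) K) : AdeleRing (𝓞 K) K := (z, a)

/-- The class in `Ŝ_K` of the adele with components `z` and `a`. -/
noncomputable def adeleClass {K : Type*} [Field K] [NumberField K] (z : InfiniteAdeleRing K)
    (a : FiniteAdeleRing (𝓞 K) K) : AdeleClassGroup K := QuotientAddGroup.mk (mkAdele z a)

variable {K L : Type*} [Field K] [NumberField K] [Field L] [NumberField L]

/-- The trace map `𝔸_L^fin → 𝔸_K^fin`: the continuous additive map that extends the trace map
`L → K` (it is unique, since `L` is dense in `𝔸_L^fin`). -/
noncomputable def finiteTrace (f : K →+* L) :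
    FiniteAdeleRing (𝓞 L) L →ₜ+ FiniteAdeleRing (𝓞 K) K :=
  (exists_finiteTrace f).choose

theorem finiteTrace_algebraMap (f : K →+* L) (x : L) :
    finiteTrace f (algebraMap L _ x) = algebraMap K _ (relTrace f x) :=
  (exists_finiteTrace f).choose_spec.1 x

theorem finiteTrace_mem (f : K →+* L) {a : FiniteAdeleRing (𝓞 L) L}
    (ha : a ∈ integralAdeles L) : finiteTrace f a ∈ integralAdeles K :=
  (exists_finiteTrace f).choose_spec.2 a ha

theorem finiteTrace_unique (f : K →+* L)
    (T : FiniteAdeleRing (𝓞 L) L → FiniteAdeleRing (𝓞 K) K) (hT : Continuous T)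
    (h : ∀ x : L, T (algebraMap L _ x) = algebraMap K _ (relTrace f x)) : T = finiteTrace f := by
  have key : ∀ v : HeightOneSpectrum (𝓞 K), ∀ a, T a v = finiteTrace f a v := by
    intro v a
    have hev : Continuous fun b : FiniteAdeleRing (𝓞 K) K => b v :=
      RestrictedProduct.continuous_eval v
    refine denseRange_finiteAdele.induction_on a ?_ fun x => ?_
    · exact isClosed_eq (hev.comp hT) (hev.comp (map_continuous (finiteTrace f)))
    · rw [h, finiteTrace_algebraMap]
  exact funext fun a => FiniteAdeleRing.ext K fun v => key v a

/-- The trace map `L_∞ → K_∞`, given by `w_σ = ∑ z_τ` over the embeddings `τ` of `L` that restrict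
to `σ` on `K`. -/
noncomputable def infiniteTrace (f : K →+* L) : InfiniteAdeleRing L →ₜ+ InfiniteAdeleRing K :=
  (exists_infiniteTrace f).choose

open scoped Classical in
theorem archCoord_infiniteTrace (f : K →+* L) (z : InfiniteAdeleRing L) (σ : K →+* ℂ) :
    archCoord σ (infiniteTrace f z) = ∑ τ : L →+* ℂ with τ.comp f = σ, archCoord τ z :=
  (exists_infiniteTrace f).choose_spec z σ

theorem infiniteTrace_algebraMap (f : K →+* L) (x : L) :
    infiniteTrace f (algebraMap L _ x) = algebraMap K _ (relTrace f x) := by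
  classical
  refine archCoord_injective fun σ => ?_
  rw [archCoord_infiniteTrace, archCoord_algebraMap]
  simp_rw [archCoord_algebraMap]
  exact sum_embeddings_eq_relTrace f σ x

/-- The trace map `𝔸_L → 𝔸_K`. -/
noncomputable def adeleTrace (f : K →+* L) : AdeleRing (𝓞 L) L →ₜ+ AdeleRing (𝓞 K) K :=
  ContinuousAddMonoidHom.prodMap (infiniteTrace f) (finiteTrace f)

theorem adeleTrace_algebraMap (f : K →+* L) (x : L) :
    adeleTrace f (algebraMap L _ x) = algebraMap K _ (relTrace f x) :=
  Prod.ext (infiniteTrace_algebraMap f x) (finiteTrace_algebraMap f x)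

/-- The trace map `Ŝ_L → Ŝ_K` induced by the trace map of adeles. -/
noncomputable def adeleClassTrace (f : K →+* L) : AdeleClassGroup L →ₜ+ AdeleClassGroup K where
  toAddMonoidHom := QuotientAddGroup.map _ _ (adeleTrace f).toAddMonoidHom (by
    rintro _ ⟨x, rfl⟩
    exact ⟨relTrace f x, (adeleTrace_algebraMap f x).symm⟩)
  continuous_toFun := by
    refine QuotientAddGroup.isOpenQuotientMap_mk.isQuotientMap.continuous_iff.2 ?_
    exact QuotientAddGroup.continuous_mk.comp (map_continuous (adeleTrace f))

/-- The trace map `𝕋_L → 𝕋_K` induced by the trace map `L_∞ → K_∞`. -/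
noncomputable def torusTrace (f : K →+* L) : MinkowskiTorus L →ₜ+ MinkowskiTorus K where
  toAddMonoidHom := QuotientAddGroup.map _ _ (infiniteTrace f).toAddMonoidHom (by
    rintro _ ⟨x, rfl⟩
    obtain ⟨y, hy⟩ := relTrace_integral f _ ⟨x, rfl⟩
    refine ⟨y, ?_⟩
    change algebraMap K (InfiniteAdeleRing K) (algebraMap (𝓞 K) K y) = _
    rw [hy]
    exact (infiniteTrace_algebraMap f _).symm)
  continuous_toFun := by
    refine QuotientAddGroup.isOpenQuotientMap_mk.isQuotientMap.continuous_iff.2 ?_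
    exact QuotientAddGroup.continuous_mk.comp (map_continuous (infiniteTrace f))

variable (K) in
theorem exists_toTorus :
    ∃ p : AdeleClassGroup K →ₜ+ MinkowskiTorus K, ∀ (z : InfiniteAdeleRing K),
      ∀ a ∈ integralAdeles K, p (adeleClass z a) = QuotientAddGroup.mk z := by
  have hch := fun a : FiniteAdeleRing (𝓞 K) K => exists_sub_mem_integralAdeles a
  choose x hx using hch
  have hlat : ∀ y : K, algebraMap K (FiniteAdeleRing (𝓞 K) K) y ∈ integralAdeles K →
      algebraMap K (InfiniteAdeleRing K) y ∈ integerLattice K := by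
    intro y hy
    obtain ⟨r, rfl⟩ := (algebraMap_mem_integralAdeles_iff y).1 hy
    exact ⟨r, rfl⟩
  let P : AdeleRing (𝓞 K) K →+ MinkowskiTorus K := AddMonoidHom.mk'
    (fun q => QuotientAddGroup.mk (q.1 - algebraMap K _ (x q.2))) fun q r => by
      rw [← QuotientAddGroup.mk_add, QuotientAddGroup.eq]
      have h1 : algebraMap K (InfiniteAdeleRing K) (x (q.2 + r.2) - (x q.2 + x r.2)) ∈
          integerLattice K := by
        refine hlat _ ?_
        have := sub_mem (add_mem (hx q.2) (hx r.2)) (hx (q.2 + r.2))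
        convert this using 1
        rw [map_sub, map_add]
        abel
      convert h1 using 1
      rw [map_sub, map_add]
      change -(q.1 + r.1 - algebraMap K (InfiniteAdeleRing K) (x (q.2 + r.2))) + _ = _
      abel
  have hP : ∀ z : InfiniteAdeleRing K, ∀ a ∈ integralAdeles K,
      P (mkAdele z a) = QuotientAddGroup.mk z := by
    intro z a ha
    change (QuotientAddGroup.mk (z - algebraMap K _ (x a)) : MinkowskiTorus K) = _
    rw [QuotientAddGroup.eq]
    have : algebraMap K (InfiniteAdeleRing K) (x a) ∈ integerLattice K := by
      refine hlat _ ?_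
      have := sub_mem ha (hx a)
      rwa [sub_sub_cancel] at this
    convert this using 1
    abel
  have hPc : Continuous P := by
    refine continuous_of_continuousAt_zero P ?_
    have h1 : Continuous fun q : AdeleRing (𝓞 K) K =>
        (QuotientAddGroup.mk (q.1 : InfiniteAdeleRing K) : MinkowskiTorus K) :=
      QuotientAddGroup.continuous_mk.comp continuous_fst
    refine (h1.continuousAt (x := 0)).congr ?_
    have hV : {q : AdeleRing (𝓞 K) K | q.2 ∈ integralAdeles K} ∈ 𝓝 (0 : AdeleRing (𝓞 K) K) :=
      (isOpen_integralAdeles.preimage continuous_snd).mem_nhds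
        (zero_mem (integralAdeles K))
    filter_upwards [hV] with q hq
    exact (hP q.1 q.2 hq).symm
  have hker : ∀ q ∈ AdeleRing.principalSubgroup (𝓞 K) K, P q = 0 := by
    rintro _ ⟨y, rfl⟩
    change (QuotientAddGroup.mk (algebraMap K (InfiniteAdeleRing K) y -
      algebraMap K _ (x (algebraMap K _ y))) : MinkowskiTorus K) = 0
    rw [QuotientAddGroup.eq_zero_iff, ← map_sub]
    refine hlat _ ?_
    rw [map_sub]
    exact hx _
  refine ⟨⟨QuotientAddGroup.lift _ P hker,
    QuotientAddGroup.isOpenQuotientMap_mk.isQuotientMap.continuous_iff.2 hPc⟩, fun z a ha => hP z a ha⟩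

variable (K) in
/-- The projection `Ŝ_K → 𝕋_K`: under `Ŝ_K = (K_∞ × Ô_K) / O_K` it is induced by the first
projection `K_∞ × Ô_K → K_∞`. -/
noncomputable def toTorus : AdeleClassGroup K →ₜ+ MinkowskiTorus K := (exists_toTorus K).choose

theorem toTorus_adeleClass (z : InfiniteAdeleRing K) {a : FiniteAdeleRing (𝓞 K) K}
    (ha : a ∈ integralAdeles K) : toTorus K (adeleClass z a) = QuotientAddGroup.mk z :=
  (exists_toTorus K).choose_spec z a ha

/-- Every adele class is represented by an adele with integral finite component. -/
theorem exists_adeleClass_eq (s : AdeleClassGroup K) :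
    ∃ z, ∃ a ∈ integralAdeles K, adeleClass z a = s := by
  induction s using QuotientAddGroup.induction_on with
  | H q =>
    obtain ⟨x, hx⟩ := exists_sub_mem_integralAdeles q.2
    refine ⟨q.1 - algebraMap K _ x, _, hx, ?_⟩
    refine QuotientAddGroup.eq.2 ⟨x, ?_⟩
    refine Prod.ext ?_ ?_
    · change algebraMap K (InfiniteAdeleRing K) x = -(q.1 - algebraMap K _ x) + q.1
      abel
    · change algebraMap K (FiniteAdeleRing (𝓞 K) K) x = -(q.2 - algebraMap K _ x) + q.2
      abel

theorem torusTrace_toTorus (f : K →+* L) (s : AdeleClassGroup L) :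
    torusTrace f (toTorus L s) = toTorus K (adeleClassTrace f s) := by
  obtain ⟨z, a, ha, rfl⟩ := exists_adeleClass_eq s
  rw [toTorus_adeleClass z ha]
  exact (toTorus_adeleClass (infiniteTrace f z) (finiteTrace_mem f ha)).symm

/-- Multiplication by `α ∈ K` on `Ŝ_K`. -/
noncomputable def adeleClassMul (α : K) : AdeleClassGroup K →ₜ+ AdeleClassGroup K where
  toAddMonoidHom := QuotientAddGroup.map _ _
    (AddMonoidHom.mulLeft (algebraMap K (AdeleRing (𝓞 K) K) α)) (by
      rintro _ ⟨x, rfl⟩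
      exact ⟨α * x, map_mul _ α x⟩)
  continuous_toFun := by
    refine QuotientAddGroup.isOpenQuotientMap_mk.isQuotientMap.continuous_iff.2 ?_
    exact QuotientAddGroup.continuous_mk.comp (continuous_const_mul _)

variable (K) in
/-- The character of `𝕋_K` induced by `z ↦ exp(2πi Tr(z))` on `K_∞`. -/
noncomputable def torusChar : CharGroup (MinkowskiTorus K) where
  toAddMonoidHom := QuotientAddGroup.lift _
    (AddMonoidHom.mk' (fun z => Additive.ofMul (Circle.exp (2 * Real.pi * absTrace K z)))
      fun z w => by rw [map_add, mul_add, Circle.exp_add]; rfl) (by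
      rintro _ ⟨x, rfl⟩
      change Additive.ofMul (Circle.exp (2 * Real.pi *
        absTrace K (algebraMap K _ (algebraMap (𝓞 K) K x)))) = 0
      rw [absTrace_algebraMap, ← Algebra.coe_trace_int]
      have := Circle.exp_two_pi_mul_int (Algebra.trace ℤ (𝓞 K) x)
      exact congrArg Additive.ofMul (by simpa using this))
  continuous_toFun := by
    refine QuotientAddGroup.isOpenQuotientMap_mk.isQuotientMap.continuous_iff.2 ?_
    exact Circle.exp.continuous.comp (continuous_const.mul continuous_absTrace)

variable (K) in
/-- The character `φ_α` of `Ŝ_K`, `φ_α(z) = φ(α z)`, where `φ` is the composite of the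
projection `Ŝ_K → 𝕋_K` and the character `z ↦ exp(2πi Tr(z))` of `𝕋_K`. -/
noncomputable def charMap (α : K) : CharGroup (AdeleClassGroup K) :=
  (torusChar K).comp ((toTorus K).comp (adeleClassMul α))

variable (K) in
/-- The inverse different `{α ∈ K | Tr(α O_K) ⊆ ℤ}`. -/
noncomputable def inverseDifferent : Submodule (𝓞 K) K := Submodule.traceDual ℤ ℚ 1

theorem mem_inverseDifferent {α : K} :
    α ∈ inverseDifferent K ↔ ∀ y : 𝓞 K, ∃ n : ℤ, Algebra.trace ℚ K (α * y) = n := by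
  simp [inverseDifferent, Submodule.mem_traceDual, Submodule.mem_one, eq_comm]

end AdeleClassGroup

section Proto

variable {E ι : Type*} [Field E] [Preorder ι] (F : ι → Subfield E) [∀ i, NumberField (F i)]
  (hF : Monotone F)

/-- The proto adele class group of a field that is the union of a directed system of number
fields `F i`: the inverse limit of the groups `Ŝ_(F i)` along the trace maps. -/
noncomputable def protoAdeleClassGroup : AddSubgroup (∀ i, AdeleClassGroup (F i)) where
  carrier := {s | ∀ i j (h : i ≤ j), adeleClassTrace (Subfield.inclusion (hF h)) (s j) = s i}
  zero_mem' i j h := map_zero _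
  add_mem' ha hb i j h := by
    rw [Pi.add_apply, Pi.add_apply, map_add, ha i j h, hb i j h]
  neg_mem' ha i j h := by
    rw [Pi.neg_apply, Pi.neg_apply, map_neg, ha i j h]

/-- The proto torus: the inverse limit of the tori `𝕋_(F i)` along the trace maps. -/
noncomputable def protoTorus : AddSubgroup (∀ i, MinkowskiTorus (F i)) where
  carrier := {s | ∀ i j (h : i ≤ j), torusTrace (Subfield.inclusion (hF h)) (s j) = s i}
  zero_mem' i j h := map_zero _
  add_mem' ha hb i j h := by
    rw [Pi.add_apply, Pi.add_apply, map_add, ha i j h, hb i j h]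
  neg_mem' ha i j h := by
    rw [Pi.neg_apply, Pi.neg_apply, map_neg, ha i j h]

/-- The projection of the proto adele class group to `Ŝ_(F i)`. -/
noncomputable def protoProj (i : ι) : protoAdeleClassGroup F hF →ₜ+ AdeleClassGroup (F i) where
  toFun s := s.1 i
  map_zero' := rfl
  map_add' _ _ := rfl
  continuous_toFun := (continuous_apply i).comp continuous_subtype_val

/-- The projection of the proto adele class group to the proto torus. -/
noncomputable def protoToTorus : protoAdeleClassGroup F hF →ₜ+ protoTorus F hF where
  toFun s := ⟨fun i => toTorus (F i) (s.1 i), fun i j h => by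
    rw [torusTrace_toTorus, s.2 i j h]⟩
  map_zero' := Subtype.ext (funext fun _ => map_zero _)
  map_add' s t := Subtype.ext (funext fun i => map_add (toTorus (F i)) (s.1 i) (t.1 i))
  continuous_toFun := Continuous.subtype_mk (continuous_pi fun i =>
    (map_continuous (toTorus (F i))).comp ((continuous_apply i).comp continuous_subtype_val)) _

/-- The character of the proto adele class group given by `α`: for some `i` with `α ∈ F i`, the
composite of the projection to `Ŝ_(F i)` and the character `φ_α` of `Ŝ_(F i)`. -/
noncomputable def protoCharMap (hcov : ∀ x : E, ∃ i, x ∈ F i) (α : E) :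
    CharGroup (protoAdeleClassGroup F hF) :=
  (charMap (F (hcov α).choose) ⟨α, (hcov α).choose_spec⟩).comp (protoProj F hF (hcov α).choose)

/-- The inverse different of an algebraic extension of `ℚ`: the union of the inverse differents of
its subfields of finite degree over `ℚ`. -/
def limitInverseDifferent (E : Type*) [Field E] : Set E :=
  {α | ∃ (M : Subfield E) (_ : NumberField M) (x : M), x ∈ inverseDifferent M ∧ (x : E) = α}

end Proto
end AdeleChar

/-! The content of (a) is that the additive group `K` is its own dual: every character of `𝔸_K / K`
is `φ_α` for exactly one `α`. The operation `⊗` is then the multiplication of `K` carried over by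
the bijection `α ↦ φ_α`.

Uniqueness holds because the trace form detects every nonzero `α`. For existence, let `χ` be a
character of the class group. The circle has no small subgroups, and some `d·Ô_K` with `d ≠ 0` in
`O_K` lies in any given neighbourhood of zero, so `s ↦ χ(d s)` kills `Ô_K`. Principal adeles are
zero in the class group, so this character also kills `O_K ⊂ K_∞`. In real coordinates `K_∞` is `ℝⁿ`
with `O_K = ℤⁿ`, a character there is the exponential of a linear functional, and triviality on `ℤⁿ`
makes the functional `2π Tr(α ·)` with `α` read off in the trace-dual basis. Every class has a
representative in `K_∞ × Ô_K`, so `χ(d s) = φ_α(s)` everywhere, and `χ = φ_{α/d}`.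

The inverse different appears because a character factors through `𝕋_K` exactly when it kills the
image of `Ô_K`. As `O_K` is dense in `Ô_K`, this says that it kills `O_K ⊂ K_∞`, which for `φ_α`
means `Tr(α O_K) ⊂ ℤ`.

For (b), a neighbourhood of zero in an inverse limit restricts only finitely many coordinates. By
the same property of the circle, a character kills the kernel of the projection to some level
(`exists_level_of_char`). The class groups are compact Hausdorff and the trace maps between them are
surjective, so the limit projects onto each level (`protoProj_surjective`) and the character
descends to that level (`exists_char_level`), where (a) applies. Naturality under traces
(`charMap_comp_adeleClassTrace`) identifies the characters of different levels along the inclusions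
of fields, so the dual of the limit is the union of the `K_λ`. -/

namespace AdeleChar

/-! ### Characters and the circle: no small subgroups, and characters of real vector spaces. -/

section Circle

/-- The circle group has no small subgroups. -/
theorem exists_nhds_forall_addSubgroup_eq_bot :
    ∃ U ∈ 𝓝 (0 : Additive Circle), ∀ H : AddSubgroup (Additive Circle),
      (H : Set (Additive Circle)) ⊆ U → H = ⊥ := by
  have hc : Continuous fun z : Additive Circle => ‖((z.toMul : Circle) : ℂ) - 1‖ :=
    ((continuous_subtype_val.comp continuous_toMul).sub continuous_const).norm
  refine ⟨{z | ‖((z.toMul : Circle) : ℂ) - 1‖ < 1 / 2},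
    (isOpen_lt hc continuous_const).mem_nhds (by simp), fun H hH => ?_⟩
  rw [eq_bot_iff]
  intro z hz
  by_contra hne
  have hpos : 0 < ‖((z.toMul : Circle) : ℂ) - 1‖ := by
    rw [norm_pos_iff, sub_ne_zero]
    intro h
    exact hne (Circle.ext h)
  -- Squaring multiplies the distance to `1` by `|w + 1|`, which is at least `2 - 1/2 = 3/2` as long
  -- as `|w - 1| < 1/2`. Repeated squaring therefore leaves the neighbourhood.
  have hgrow : ∀ n : ℕ, (3 / 2 : ℝ) ^ n * ‖((z.toMul : Circle) : ℂ) - 1‖ ≤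
      ‖((((2 ^ n : ℕ) • z).toMul : Circle) : ℂ) - 1‖ := by
    intro n
    induction n with
    | zero => simp
    | succ n ih =>
      have hlt : ‖((((2 ^ n : ℕ) • z).toMul : Circle) : ℂ) - 1‖ < 1 / 2 :=
        hH (H.nsmul_mem hz _)
      have hsq : ((((2 ^ (n + 1) : ℕ) • z).toMul : Circle) : ℂ) =
          ((((2 ^ n : ℕ) • z).toMul : Circle) : ℂ) ^ 2 := by
        rw [pow_succ, mul_nsmul]
        rfl
      rw [hsq]
      generalize ((((2 ^ n : ℕ) • z).toMul : Circle) : ℂ) = w at *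
      have h1 : w ^ 2 - 1 = (w + 1) * (w - 1) := by ring
      have h2 : (3 / 2 : ℝ) ≤ ‖w + 1‖ := by
        have h3 : (2 : ℂ) = (w + 1) - (w - 1) := by ring
        have h4 : ‖(2 : ℂ)‖ ≤ ‖w + 1‖ + ‖w - 1‖ := by
          conv_lhs => rw [h3]
          exact norm_sub_le _ _
        rw [Complex.norm_ofNat] at h4
        linarith
      rw [h1, norm_mul, pow_succ]
      nlinarith [norm_nonneg (w - 1)]
  obtain ⟨n, hn⟩ := pow_unbounded_of_one_lt (1 / 2 / ‖((z.toMul : Circle) : ℂ) - 1‖)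
    (by norm_num : (1 : ℝ) < 3 / 2)
  rw [div_lt_iff₀ hpos] at hn
  have : ‖((((2 ^ n : ℕ) • z).toMul : Circle) : ℂ) - 1‖ < 1 / 2 := hH (H.nsmul_mem hz _)
  linarith [hgrow n]

/-- A character kills every subgroup contained in a sufficiently small neighbourhood of zero. -/
theorem exists_nhds_forall_addSubgroup_le_ker {G : Type*} [AddCommGroup G] [TopologicalSpace G]
    (χ : CharGroup G) :
    ∃ U ∈ 𝓝 (0 : G), ∀ H : AddSubgroup G, (H : Set G) ⊆ U → ∀ x ∈ H, χ x = 0 := by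
  obtain ⟨U, hU, h⟩ := exists_nhds_forall_addSubgroup_eq_bot
  refine ⟨χ ⁻¹' U, (map_continuous χ).continuousAt.preimage_mem_nhds (by rwa [map_zero]),
    fun H hH x hx => ?_⟩
  have := h (H.map χ.toAddMonoidHom) (by rintro _ ⟨y, hy, rfl⟩; exact hH hy)
  have hx' : χ x ∈ H.map χ.toAddMonoidHom := ⟨x, hx, rfl⟩
  rw [this] at hx'
  exact hx'

/-- The characters of a real vector space are exponentials of continuous linear functionals. -/
theorem exists_clm_forall_eq_exp {V : Type*} [NormedAddCommGroup V] [NormedSpace ℝ V]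
    (χ : CharGroup V) :
    ∃ g : V →L[ℝ] ℝ, ∀ v, χ v = Additive.ofMul (Circle.exp (g v)) := by
  have hone : (χ 0).toMul = 1 := by rw [map_zero]; rfl
  obtain ⟨g, ⟨hg0, hg⟩, -⟩ := Circle.isCoveringMap_exp.existsUnique_continuousMap_lifts
    (A := V) ⟨fun v => (χ v).toMul, map_continuous χ⟩ 0 0 (Circle.exp_zero.trans hone.symm)
  have hg' : ∀ v, Circle.exp (g v) = (χ v).toMul := fun v => congrFun hg v
  have hadd : ∀ v w, g (v + w) = g v + g w := by
    intro v w
    -- Both `g` and `x ↦ g (x + w) - g w` lift the character through `Circle.exp` and vanish at `0`,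
    -- so uniqueness of lifts gives additivity.
    obtain ⟨F, -, hF⟩ := Circle.isCoveringMap_exp.existsUnique_continuousMap_lifts
      (A := V) ⟨fun v => (χ v).toMul, map_continuous χ⟩ 0 0 (Circle.exp_zero.trans hone.symm)
    have h1 := hF g ⟨hg0, hg⟩
    have h2 := hF ⟨fun x => g (x + w) - g w, by fun_prop⟩ ⟨by simp, funext fun x => by
      change Circle.exp (g (x + w) - g w) = _
      rw [Circle.exp_sub, hg', hg', map_add]
      exact mul_div_cancel_right _ _⟩
    have h3 := DFunLike.congr_fun (h1.trans h2.symm) v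
    change g v = g (v + w) - g w at h3
    linarith
  exact ⟨(AddMonoidHom.mk' g hadd).toRealLinearMap g.continuous,
    fun v => congrArg Additive.ofMul (hg' v).symm⟩

end Circle

/-! ### Nonemptiness of compact inverse limits. -/

section InverseLimit

/-- An inverse limit over a directed set of nonempty compact subsets of Hausdorff spaces is
nonempty. -/
theorem exists_forall_mem_of_isCompact {ι : Type*} [Preorder ι] [IsDirectedOrder ι]
    {X : ι → Type*} [∀ i, TopologicalSpace (X i)] [∀ i, T2Space (X i)]
    (f : ∀ i j, i ≤ j → X j → X i) (hf : ∀ i j h, Continuous (f i j h))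
    (hcomp : ∀ i j k (hij : i ≤ j) (hjk : j ≤ k) x,
      f i j hij (f j k hjk x) = f i k (hij.trans hjk) x)
    (C : ∀ i, Set (X i)) (hC : ∀ i, IsCompact (C i)) (hne : ∀ i, (C i).Nonempty)
    (hmaps : ∀ i j h, Set.MapsTo (f i j h) (C j) (C i)) :
    ∃ x : ∀ i, X i, (∀ i, x i ∈ C i) ∧ ∀ i j h, f i j h (x j) = x i := by
  classical
  rcases isEmpty_or_nonempty ι with hι | hι
  · exact ⟨fun i => isEmptyElim i, fun i => isEmptyElim i, fun i => isEmptyElim i⟩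
  -- `D k` requires only that the coordinates below `k` come from the coordinate `k`. These sets
  -- shrink as `k` grows, and a single point of `C k`, pushed down, already gives an element of `D
  -- k`.
  let D : ι → Set (∀ i, X i) := fun k =>
    Set.univ.pi C ∩ {x | ∀ i (h : i ≤ k), f i k h (x k) = x i}
  have hclosed : ∀ k, IsClosed (D k) := by
    intro k
    refine (isCompact_univ_pi hC).isClosed.inter ?_
    simp only [Set.ofPred_forall]
    refine isClosed_iInter fun i => isClosed_iInter fun h => ?_
    exact isClosed_eq ((hf i k h).comp (continuous_apply k)) (continuous_apply i)
  have hmono : ∀ k l, k ≤ l → D l ⊆ D k := by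
    intro k l hkl x hx
    refine ⟨hx.1, fun i h => ?_⟩
    rw [← hx.2 k hkl, hcomp, hx.2]
  obtain ⟨x, hx⟩ := IsCompact.nonempty_iInter_of_directed_nonempty_isCompact_isClosed D
    (fun k l => by
      obtain ⟨m, hk, hl⟩ := exists_ge_ge k l
      exact ⟨m, hmono k m hk, hmono l m hl⟩)
    (fun k => by
      choose c hc using hne
      refine ⟨fun i => if h : i ≤ k then f i k h (c k) else c i, fun i _ => ?_, fun i h => ?_⟩
      · by_cases h : i ≤ k
        · simp only [h, dite_true]
          exact hmaps i k h (hc k)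
        · simp only [h, dite_false]
          exact hc i
      · simp [h, hcomp])
    (fun k => (isCompact_univ_pi hC).of_isClosed_subset (hclosed k) Set.inter_subset_left)
    hclosed
  rw [Set.mem_iInter] at hx
  exact ⟨x, fun i => (hx hι.some).1 i trivial, fun i j h => (hx j).2 i h⟩

end InverseLimit

/-! ### `K_∞` as a real vector space with lattice `O_K`. -/

section RealCoordinates

open NumberField.InfinitePlace NumberField.InfinitePlace.Completion

variable (K : Type*) [Field K] [NumberField K]

instance : T2Space (InfiniteAdeleRing K) :=
  inferInstanceAs (T2Space ((v : InfinitePlace K) → v.Completion))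

instance : T2Space (FiniteAdeleRing (𝓞 K) K) :=
  inferInstanceAs (T2Space (RestrictedProduct
    (fun v : HeightOneSpectrum (𝓞 K) => v.adicCompletion K)
    (fun v => v.adicCompletionIntegers K) cofinite))

instance : T2Space (AdeleRing (𝓞 K) K) :=
  inferInstanceAs (T2Space (InfiniteAdeleRing K × FiniteAdeleRing (𝓞 K) K))

/-- The coordinates come from the lattice basis of the mixed space. A continuous surjection from
`ℝⁿ` is enough later on: characters are pulled back along it and the unit cube is pushed forward. -/
theorem exists_realCoordinates :
    ∃ e : (Module.Free.ChooseBasisIndex ℤ (𝓞 K) → ℝ) →ₜ+ InfiniteAdeleRing K,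
      Function.Surjective e ∧ ∀ i, e (Pi.single i 1) = algebraMap K _ (integralBasis K i) := by
  classical
  let b := mixedEmbedding.latticeBasis K
  let E := InfiniteAdeleRing.ringEquiv_mixedSpace K
  let e : (Module.Free.ChooseBasisIndex ℤ (𝓞 K) → ℝ) →+ InfiniteAdeleRing K :=
    E.symm.toAddEquiv.toAddMonoidHom.comp b.equivFun.symm.toLinearMap.toAddMonoidHom
  have hE : ∀ r, E (e r) = b.equivFun.symm r := fun r => E.apply_symm_apply _
  have hcont : Continuous b.equivFun.symm :=
    LinearMap.continuous_of_finiteDimensional b.equivFun.symm.toLinearMap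
  -- Continuity is tested at each place, where the completion embeds isometrically in `ℝ` or `ℂ` and
  -- the coordinate becomes a linear function on `ℝⁿ`.
  have hc : Continuous e := by
    refine continuous_pi fun v => ?_
    by_cases hv : v.IsReal
    · rw [(isometry_extensionEmbeddingOfIsReal hv).isEmbedding.continuous_iff]
      have h : ∀ r, extensionEmbeddingOfIsReal hv (e r v) = (b.equivFun.symm r).1 ⟨v, hv⟩ :=
        fun r => congrFun (congrArg Prod.fst (hE r)) ⟨v, hv⟩
      exact ((continuous_apply _).comp (continuous_fst.comp hcont)).congr fun r => (h r).symm
    · rw [not_isReal_iff_isComplex] at hv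
      rw [(isometry_extensionEmbedding v).isEmbedding.continuous_iff]
      have h : ∀ r, extensionEmbedding v (e r v) = (b.equivFun.symm r).2 ⟨v, hv⟩ :=
        fun r => congrFun (congrArg Prod.snd (hE r)) ⟨v, hv⟩
      exact ((continuous_apply _).comp (continuous_snd.comp hcont)).congr fun r => (h r).symm
  refine ⟨⟨e, hc⟩, E.symm.surjective.comp b.equivFun.symm.surjective, fun i => ?_⟩
  refine E.injective ((hE _).trans ?_)
  rw [← InfiniteAdeleRing.mixedEmbedding_eq_algebraMap_comp, ← mixedEmbedding.latticeBasis_apply]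
  simp [b]

/-- The image of the unit cube serves as `C`: the lattice vector to subtract has the integer parts
of the coordinates. -/
theorem exists_isCompact_add_integerLattice :
    ∃ C : Set (InfiniteAdeleRing K), IsCompact C ∧ ∀ z, ∃ y ∈ integerLattice K, z - y ∈ C := by
  classical
  obtain ⟨e, he, heb⟩ := exists_realCoordinates K
  refine ⟨e '' Set.univ.pi fun _ => Set.Icc 0 1,
    (isCompact_univ_pi fun _ => isCompact_Icc).image (map_continuous e), fun z => ?_⟩
  obtain ⟨r, rfl⟩ := he z
  refine ⟨e fun i => (⌊r i⌋ : ℝ), ?_, fun i => Int.fract (r i), fun i _ =>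
    ⟨Int.fract_nonneg _, (Int.fract_lt_one _).le⟩, ?_⟩
  · have h : (fun i => (⌊r i⌋ : ℝ)) = ∑ i, ⌊r i⌋ • Pi.single i (1 : ℝ) := by
      funext j
      simp [Finset.sum_apply, Pi.single_apply]
    rw [h, map_sum]
    refine sum_mem fun i _ => ?_
    rw [map_zsmul, heb]
    rw [integralBasis_apply]
    exact zsmul_mem (show _ ∈ integerLattice K from ⟨RingOfIntegers.basis K i, rfl⟩) _
  · rw [← map_sub]
    rfl

/-- A nonzero algebraic integer has absolute value at least `1` at some infinite place, so the open
unit polydisc contains no other integer than `0`. -/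
theorem exists_isOpen_integerLattice :
    ∃ U : Set (InfiniteAdeleRing K), IsOpen U ∧ 0 ∈ U ∧
      ∀ y : 𝓞 K, algebraMap K (InfiniteAdeleRing K) (y : K) ∈ U → y = 0 := by
  refine ⟨{z | ∀ v : InfinitePlace K, ‖z v‖ < 1}, ?_, fun v => ?_, fun y hy => ?_⟩
  · simp only [Set.ofPred_forall]
    exact isOpen_iInter_of_finite fun v =>
      isOpen_lt (continuous_norm.comp (continuous_apply v)) continuous_const
  · change ‖(0 : v.Completion)‖ < 1
    simp
  · by_contra hne
    obtain ⟨w⟩ := (inferInstance : Nonempty (InfinitePlace K))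
    have hlt : ∀ v : InfinitePlace K, v (y : K) < 1 := by
      intro v
      have h := hy v
      change ‖((y : K) : v.Completion)‖ < 1 at h
      have h2 := norm_coe v (WithAbs.toAbs _ (y : K))
      exact lt_of_eq_of_lt h2.symm h
    exact absurd (one_le_of_lt_one (w := w) hne fun v _ => hlt v) (not_le.2 (hlt w))

end RealCoordinates

/-! ### Compactness of `Ô_K` and of the adele class group. -/

section Compactness

variable {K : Type*} [Field K] [NumberField K]

/-- An approximation of `a` by `x ∈ K` is automatically `v`-integral by the ultrametric inequality,
and a `v`-integral element of `K` is approximated by elements of `O_K`. -/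
theorem exists_integer_sub_le (v : HeightOneSpectrum (𝓞 K)) {a : v.adicCompletion K}
    (ha : a ∈ v.adicCompletionIntegers K) (m : ℕ) :
    ∃ r : 𝓞 K, Valued.v (a - ((r : K) : v.adicCompletion K)) ≤ exp (-(m : ℤ)) := by
  have hcont : Tendsto (fun y : v.adicCompletion K => a - y) (𝓝 a) (𝓝 0) := by
    have : Continuous (fun y : v.adicCompletion K => a - y) := by fun_prop
    simpa using this.tendsto a
  obtain ⟨x, hx⟩ := (v.denseRange_algebraMap K).exists_mem_open isOpen_interior
    ⟨_, mem_interior_iff_mem_nhds.2 (hcont (ball_mem_nhds v m))⟩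
  have hx' : Valued.v (a - (x : v.adicCompletion K)) ≤ exp (-(m : ℤ)) := by
    have := interior_subset hx
    exact this
  have hx1 : v.valuation K x ≤ 1 := by
    rw [← v.valuedAdicCompletion_eq_valuation', ← sub_sub_cancel a (x : v.adicCompletion K)]
    refine (Valuation.map_sub _ _ _).trans (max_le ha (hx'.trans ?_))
    rw [← exp_zero, exp_le_exp]
    simp
  obtain ⟨r, hr⟩ := v.exists_valuation_sub_lt_of_integer hx1 (Units.mk0 (exp (-(m : ℤ))) (by simp))
  refine ⟨r, ?_⟩
  have : a - ((r : K) : v.adicCompletion K) =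
      (a - (x : v.adicCompletion K)) - (((r : K) - x : K) : v.adicCompletion K) := by
    rw [show (((r : K) - x : K) : v.adicCompletion K) = (r : K) - (x : v.adicCompletion K) from
      map_sub (algebraMap K (v.adicCompletion K)) _ _]
    ring
  rw [this]
  refine (Valuation.map_sub _ _ _).trans (max_le hx' ?_)
  rw [v.valuedAdicCompletion_eq_valuation']
  exact hr.le

/-- The local integers are closed in a complete field, so total boundedness suffices.
Representatives of the finite ring `O_K / v^m` are centres of balls that cover them. -/
theorem isCompact_adicCompletionIntegers (v : HeightOneSpectrum (𝓞 K)) :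
    IsCompact (v.adicCompletionIntegers K : Set (v.adicCompletion K)) := by
  refine TotallyBounded.isCompact_of_isClosed ?_ (Valued.isClosed_valuationSubring _)
  rw [totallyBounded_iff_subset_finite_iUnion_nhds_zero]
  intro U hU
  obtain ⟨m, hm⟩ := exists_ball_subset v hU
  have hfin : Finite (𝓞 K ⧸ v.asIdeal ^ m) :=
    Ideal.finiteQuotientOfFreeOfNeBot _ (pow_ne_zero m v.ne_bot)
  let s : 𝓞 K ⧸ v.asIdeal ^ m → v.adicCompletion K := fun q => ((q.out : 𝓞 K) : K)
  refine ⟨Set.range s, Set.finite_range s, fun a ha => ?_⟩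
  obtain ⟨r, hr⟩ := exists_integer_sub_le v ha m
  refine Set.mem_biUnion ⟨Ideal.Quotient.mk _ r, rfl⟩ ?_
  rw [Set.mem_vadd_set_iff_neg_vadd_mem, vadd_eq_add]
  refine hm ?_
  set q := (Ideal.Quotient.mk (v.asIdeal ^ m) r).out with hq
  have h1 : r - q ∈ v.asIdeal ^ m := by
    rw [← Ideal.Quotient.eq, hq]
    exact (Quotient.out_eq _).symm
  rw [← v.intValuation_le_pow_iff_mem, ← v.valuation_of_algebraMap (K := K)] at h1
  have h2 : -s (Ideal.Quotient.mk _ r) + a = (a - ((r : K) : v.adicCompletion K)) +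
      ((algebraMap (𝓞 K) K (r - q) : K) : v.adicCompletion K) := by
    rw [show ((algebraMap (𝓞 K) K (r - q) : K) : v.adicCompletion K) =
      (r : K) - ((q : K) : v.adicCompletion K) by
        rw [map_sub]; exact map_sub (algebraMap K (v.adicCompletion K)) _ _]
    change -((q : K) : v.adicCompletion K) + a = _
    ring
  rw [Set.mem_ofPred_eq, h2]
  refine (Valuation.map_add _ _ _).trans (max_le hr ?_)
  rwa [v.valuedAdicCompletion_eq_valuation']

/-- This is Tychonoff's theorem: `Ô_K` is the continuous image of the product of the compact rings
of local integers. -/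
theorem isCompact_integralAdeles :
    IsCompact (integralAdeles K : Set (FiniteAdeleRing (𝓞 K) K)) := by
  let φ : (∀ v : HeightOneSpectrum (𝓞 K),
      (v.adicCompletionIntegers K : Set (v.adicCompletion K))) → FiniteAdeleRing (𝓞 K) K :=
    RestrictedProduct.structureMap (fun v : HeightOneSpectrum (𝓞 K) => v.adicCompletion K)
      (fun v => (v.adicCompletionIntegers K : Set (v.adicCompletion K))) cofinite
  have hφ : Continuous φ := RestrictedProduct.isEmbedding_structureMap.continuous
  have hc : ∀ v : HeightOneSpectrum (𝓞 K),
      CompactSpace (v.adicCompletionIntegers K : Set (v.adicCompletion K)) :=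
    fun v => isCompact_iff_compactSpace.1 (isCompact_adicCompletionIntegers v)
  convert isCompact_range hφ
  ext a
  constructor
  · exact fun ha => ⟨fun v => ⟨a v, ha v⟩, rfl⟩
  · rintro ⟨c, rfl⟩ v
    exact (c v).2

theorem continuous_adeleClass :
    Continuous fun q : InfiniteAdeleRing K × FiniteAdeleRing (𝓞 K) K => adeleClass q.1 q.2 :=
  QuotientAddGroup.continuous_mk

theorem adeleClass_add (z w : InfiniteAdeleRing K) (a b : FiniteAdeleRing (𝓞 K) K) :
    adeleClass (z + w) (a + b) = adeleClass z a + adeleClass w b :=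
  rfl

theorem adeleClass_algebraMap (x : K) :
    adeleClass (algebraMap K (InfiniteAdeleRing K) x)
      (algebraMap K (FiniteAdeleRing (𝓞 K) K) x) = 0 :=
  (QuotientAddGroup.eq_zero_iff _).2 ⟨x, rfl⟩

/-- An element of `K` that is integral at all finite places lies in `O_K`, and if it is also small
at the infinite places it is `0`. So `K` is discrete in the Hausdorff group `𝔸_K`, hence closed. -/
theorem isClosed_principalSubgroup :
    IsClosed (AdeleRing.principalSubgroup (𝓞 K) K : Set (AdeleRing (𝓞 K) K)) := by
  obtain ⟨U, hU, h0, h⟩ := exists_isOpen_integerLattice K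
  have hV : IsOpen {q : AdeleRing (𝓞 K) K | q.1 ∈ U ∧ q.2 ∈ integralAdeles K} :=
    hU.prod isOpen_integralAdeles
  have : DiscreteTopology (AdeleRing.principalSubgroup (𝓞 K) K) := by
    refine discreteTopology_of_isOpen_singleton_zero ?_
    convert hV.preimage continuous_subtype_val
    ext ⟨q, hq⟩
    rw [Set.mem_singleton_iff]
    constructor
    · intro h
      obtain rfl : q = 0 := congrArg Subtype.val h
      exact ⟨h0, zero_mem (integralAdeles K)⟩
    · rintro ⟨h1, h2⟩
      obtain ⟨x, rfl⟩ := hq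
      obtain ⟨y, rfl⟩ := (algebraMap_mem_integralAdeles_iff x).1 h2
      obtain rfl := h y h1
      exact Subtype.ext (by simp)
  exact AddSubgroup.isClosed_of_discrete

instance : T2Space (AdeleClassGroup K) := by
  have : IsClosed (AdeleRing.principalSubgroup (𝓞 K) K : Set (AdeleRing (𝓞 K) K)) :=
    isClosed_principalSubgroup
  infer_instance

/-- Representatives can be taken in `K_∞ × Ô_K`. Subtracting a principal adele from `O_K` moves the
infinite component into a compact set and keeps the finite one in `Ô_K`. -/
instance : CompactSpace (AdeleClassGroup K) := by
  obtain ⟨C, hC, h⟩ := exists_isCompact_add_integerLattice K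
  refine ⟨?_⟩
  convert (hC.prod (isCompact_integralAdeles (K := K))).image continuous_adeleClass
  refine (Set.eq_univ_of_forall fun s => ?_).symm
  obtain ⟨z, a, ha, rfl⟩ := exists_adeleClass_eq s
  obtain ⟨_, ⟨y, rfl⟩, hy⟩ := h z
  refine ⟨(z - algebraMap K _ (y : K), a - algebraMap K _ (y : K)), ⟨hy, sub_mem ha
    ((algebraMap_mem_integralAdeles_iff _).2 ⟨y, rfl⟩)⟩, ?_⟩
  have h1 := adeleClass_add (z - algebraMap K _ (y : K)) (algebraMap K _ (y : K))
    (a - algebraMap K _ (y : K)) (algebraMap K _ (y : K))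
  rw [adeleClass_algebraMap, add_zero, sub_add_cancel, sub_add_cancel] at h1
  exact h1.symm

end Compactness

/-! ### The characters of the adele class group of a number field. -/

section NumberFieldCharacters

theorem char_comp_apply {G H : Type*} [AddCommGroup G] [TopologicalSpace G] [AddCommGroup H]
    [TopologicalSpace H] (χ : CharGroup H) (f : G →ₜ+ H) (x : G) : χ.comp f x = χ (f x) :=
  rfl

variable {K : Type*} [Field K] [NumberField K]

theorem adeleClass_eq_add (z : InfiniteAdeleRing K) (a : FiniteAdeleRing (𝓞 K) K) :
    adeleClass z a = adeleClass z 0 + adeleClass 0 a := by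
  rw [← adeleClass_add, add_zero, zero_add]

/-- This relation turns conditions on `O_K ⊂ K_∞` into conditions on `O_K ⊂ Ô_K`, and back. -/
theorem adeleClass_algebraMap_zero (x : K) :
    adeleClass (algebraMap K (InfiniteAdeleRing K) x) 0 =
      -adeleClass 0 (algebraMap K (FiniteAdeleRing (𝓞 K) K) x) := by
  rw [eq_neg_iff_add_eq_zero, ← adeleClass_eq_add, adeleClass_algebraMap]

theorem adeleClassMul_adeleClass (α : K) (z : InfiniteAdeleRing K)
    (a : FiniteAdeleRing (𝓞 K) K) :
    adeleClassMul α (adeleClass z a) = adeleClass (algebraMap K _ α * z) (algebraMap K _ α * a) :=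
  rfl

theorem exists_adeleClass_eq' (s : AdeleClassGroup K) : ∃ z a, adeleClass z a = s :=
  let ⟨z, a, _, h⟩ := exists_adeleClass_eq s
  ⟨z, a, h⟩

theorem adeleClassMul_add (α β : K) (s : AdeleClassGroup K) :
    adeleClassMul (α + β) s = adeleClassMul α s + adeleClassMul β s := by
  obtain ⟨z, a, rfl⟩ := exists_adeleClass_eq' s
  simp only [adeleClassMul_adeleClass, ← adeleClass_add, map_add, add_mul]

theorem adeleClassMul_mul (α β : K) (s : AdeleClassGroup K) :
    adeleClassMul (α * β) s = adeleClassMul α (adeleClassMul β s) := by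
  obtain ⟨z, a, rfl⟩ := exists_adeleClass_eq' s
  simp only [adeleClassMul_adeleClass, map_mul, mul_assoc]

theorem adeleClassMul_one (s : AdeleClassGroup K) : adeleClassMul 1 s = s := by
  obtain ⟨z, a, rfl⟩ := exists_adeleClass_eq' s
  simp only [adeleClassMul_adeleClass, map_one, one_mul]

theorem charMap_apply (α : K) (s : AdeleClassGroup K) :
    charMap K α s = torusChar K (toTorus K (adeleClassMul α s)) :=
  rfl

theorem charMap_add (α β : K) : charMap K (α + β) = charMap K α + charMap K β := by
  refine ContinuousAddMonoidHom.ext fun s => ?_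
  rw [charMap_apply, adeleClassMul_add, map_add, map_add]
  rfl

theorem charMap_mul_apply (α β : K) (s : AdeleClassGroup K) :
    charMap K (α * β) s = charMap K α (adeleClassMul β s) := by
  rw [charMap_apply, adeleClassMul_mul, charMap_apply]

theorem torusChar_mk (z : InfiniteAdeleRing K) :
    torusChar K (QuotientAddGroup.mk z) =
      Additive.ofMul (Circle.exp (2 * Real.pi * absTrace K z)) :=
  rfl

theorem charMap_adeleClass_zero (α : K) (z : InfiniteAdeleRing K) :
    charMap K α (adeleClass z 0) =
      Additive.ofMul (Circle.exp (2 * Real.pi * absTrace K (algebraMap K _ α * z))) := by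
  rw [charMap_apply, adeleClassMul_adeleClass, mul_zero,
    toTorus_adeleClass _ (zero_mem (integralAdeles K)), torusChar_mk]

theorem charMap_algebraMap_zero (α x : K) :
    charMap K α (adeleClass (algebraMap K _ x) 0) =
      Additive.ofMul (Circle.exp (2 * Real.pi * (Algebra.trace ℚ K (α * x) : ℚ))) := by
  rw [charMap_adeleClass_zero, ← map_mul, absTrace_algebraMap]

theorem exp_two_pi_mul_eq_one_iff (t : ℝ) :
    Circle.exp (2 * Real.pi * t) = 1 ↔ ∃ n : ℤ, t = n := by
  rw [Circle.exp_eq_one]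
  refine exists_congr fun n => ?_
  have := Real.pi_pos.ne'
  constructor
  · intro h
    refine mul_left_cancel₀ (mul_ne_zero two_ne_zero this) ?_
    rw [h]
    ring
  · rintro rfl
    ring

theorem charMap_injective : Function.Injective (charMap K) := by
  refine (injective_iff_map_eq_zero (AddMonoidHom.mk' (charMap K) charMap_add)).2 fun α hα => ?_
  by_contra hne
  have hd : (Module.finrank ℚ K : ℚ) ≠ 0 := by
    exact_mod_cast (Module.finrank_pos (R := ℚ) (M := K)).ne'
  -- With `n = [K : ℚ]`, the test point `x = α⁻¹ / (2n)` has `Tr(α x) = 1/2`, so `φ_α` would take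
  -- the value `-1` there.
  have h := charMap_algebraMap_zero α
    (α⁻¹ * algebraMap ℚ K ((2 * (Module.finrank ℚ K : ℚ))⁻¹))
  have h0 : charMap K α = 0 := hα
  rw [h0, mul_inv_cancel_left₀ hne, Algebra.trace_algebraMap, nsmul_eq_mul] at h
  obtain ⟨n, hn⟩ := (exp_two_pi_mul_eq_one_iff _).1 (congrArg Additive.toMul h).symm
  have h2 : (Module.finrank ℚ K : ℚ) * (2 * (Module.finrank ℚ K : ℚ))⁻¹ = 1 / 2 := by
    field_simp
  rw [h2] at hn
  have h3 : (1 : ℤ) = 2 * n := by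
    have : (1 : ℝ) = 2 * n := by
      rw [← hn]
      norm_num
    exact_mod_cast this
  omega

theorem charMap_integer_eq_zero_iff (α : K) (y : 𝓞 K) :
    charMap K α (adeleClass (algebraMap K _ (y : K)) 0) = 0 ↔
      ∃ n : ℤ, Algebra.trace ℚ K (α * y) = n := by
  rw [charMap_algebraMap_zero]
  refine Iff.trans (exp_two_pi_mul_eq_one_iff _) (exists_congr fun n => ?_)
  exact_mod_cast Iff.rfl

theorem mem_inverseDifferent_iff_charMap (α : K) :
    α ∈ inverseDifferent K ↔
      ∀ y : 𝓞 K, charMap K α (adeleClass (algebraMap K _ (y : K)) 0) = 0 := by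
  simp_rw [charMap_integer_eq_zero_iff, mem_inverseDifferent]

/-- A character of the adele class group that kills the image of the ring of integers in the
infinite adeles kills the integral finite adeles. -/
theorem eq_zero_of_mem_integralAdeles {χ : CharGroup (AdeleClassGroup K)}
    (h : ∀ y : 𝓞 K, χ (adeleClass (algebraMap K _ (y : K)) 0) = 0)
    {a : FiniteAdeleRing (𝓞 K) K} (ha : a ∈ integralAdeles K) : χ (adeleClass 0 a) = 0 := by
  -- `K` is dense in the finite adeles and `Ô_K` is open, so `K ∩ Ô_K = O_K` is dense in `Ô_K`.
  have h1 : a ∈ closure ((integralAdeles K : Set (FiniteAdeleRing (𝓞 K) K)) ∩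
      Set.range (algebraMap K (FiniteAdeleRing (𝓞 K) K))) :=
    denseRange_finiteAdele.open_subset_closure_inter isOpen_integralAdeles ha
  have hc : Continuous fun a : FiniteAdeleRing (𝓞 K) K => χ (adeleClass 0 a) :=
    (map_continuous χ).comp (continuous_adeleClass.comp (continuous_const.prodMk continuous_id))
  have h2 : IsClosed {a : FiniteAdeleRing (𝓞 K) K | χ (adeleClass 0 a) = 0} :=
    isClosed_eq hc continuous_const
  refine closure_minimal ?_ h2 h1
  rintro _ ⟨hx, x, rfl⟩
  obtain ⟨y, rfl⟩ := (algebraMap_mem_integralAdeles_iff x).1 hx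
  have := h y
  rwa [adeleClass_algebraMap_zero, map_neg, neg_eq_zero] at this

theorem mem_inverseDifferent_of_integralAdeles {α : K}
    (h : ∀ a ∈ integralAdeles K, charMap K α (adeleClass 0 a) = 0) : α ∈ inverseDifferent K := by
  rw [mem_inverseDifferent_iff_charMap]
  intro y
  rw [adeleClass_algebraMap_zero, map_neg, h _ ((algebraMap_mem_integralAdeles_iff _).2 ⟨y, rfl⟩),
    neg_zero]

/-- A neighbourhood of zero in the finite adeles contains a multiple of the integral adeles. -/
theorem exists_integer_mul_integralAdeles_subset {U : Set (FiniteAdeleRing (𝓞 K) K)}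
    (hU : U ∈ 𝓝 (0 : FiniteAdeleRing (𝓞 K) K)) :
    ∃ d : 𝓞 K, d ≠ 0 ∧ ∀ a ∈ integralAdeles K, algebraMap K _ (d : K) * a ∈ U := by
  classical
  obtain ⟨T, m, hT, h⟩ := exists_box_subset hU
  obtain ⟨d, hdI, hd0⟩ : ∃ d ∈ ∏ v ∈ hT.toFinset, v.asIdeal ^ m, d ≠ (0 : 𝓞 K) := by
    apply Submodule.exists_mem_ne_zero_of_ne_bot
    rw [Ne, ← Ideal.zero_eq_bot, Finset.prod_eq_zero_iff]
    rintro ⟨v, -, hv⟩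
    exact v.ne_bot (by simpa using eq_zero_of_pow_eq_zero hv)
  refine ⟨d, hd0, fun a ha => h _ fun v => ?_⟩
  have hmul : Valued.v ((algebraMap K (FiniteAdeleRing (𝓞 K) K) (d : K) * a) v) =
      v.valuation K (d : K) * Valued.v (a v) := by
    rw [← v.valuedAdicCompletion_eq_valuation', ← map_mul]
    rfl
  have hav : Valued.v (a v) ≤ 1 := ha v
  rw [hmul]
  refine ⟨mul_le_one' (v.valuation_le_one d) hav, fun hv => ?_⟩
  refine (mul_le_of_le_one_right' hav).trans ?_
  have hmem : d ∈ v.asIdeal ^ m :=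
    Ideal.le_of_dvd (Finset.dvd_prod_of_mem (fun v : HeightOneSpectrum (𝓞 K) => v.asIdeal ^ m)
      (a := v) (by simpa using hv)) hdI
  have := (v.intValuation_le_pow_iff_mem d m).2 hmem
  rwa [← v.valuation_of_algebraMap (K := K)] at this

/-- The characters of the infinite adeles that are trivial on the ring of integers. -/
theorem exists_charMap_eq_on_infiniteAdele (χ : CharGroup (AdeleClassGroup K))
    (h : ∀ y : 𝓞 K, χ (adeleClass (algebraMap K _ (y : K)) 0) = 0) :
    ∃ α : K, ∀ z, charMap K α (adeleClass z 0) = χ (adeleClass z 0) := by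
  classical
  obtain ⟨e, he, heb⟩ := exists_realCoordinates K
  have hinf : Continuous fun z : InfiniteAdeleRing K => adeleClass z 0 :=
    continuous_adeleClass.comp (continuous_id.prodMk continuous_const)
  let ψ : CharGroup (Module.Free.ChooseBasisIndex ℤ (𝓞 K) → ℝ) :=
    { toFun := fun r => χ (adeleClass (e r) 0)
      map_zero' := by rw [map_zero]; exact map_zero χ
      map_add' := fun r s => by
        rw [map_add, ← map_add χ, ← adeleClass_add, add_zero]
      continuous_toFun := (map_continuous χ).comp (hinf.comp (map_continuous e)) }
  obtain ⟨g, hg⟩ := exists_clm_forall_eq_exp ψ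
  have hn : ∀ i, ∃ n : ℤ, g (Pi.single i 1) = 2 * Real.pi * n := by
    intro i
    have h1 : ψ (Pi.single i 1) = 0 := by
      change χ (adeleClass (e (Pi.single i 1)) 0) = 0
      rw [heb, integralBasis_apply]
      exact h _
    rw [hg] at h1
    obtain ⟨n, hn⟩ := Circle.exp_eq_one.1 (congrArg Additive.toMul h1)
    exact ⟨n, hn.trans (mul_comm _ _)⟩
  choose n hn using hn
  -- Expanding in the trace-dual basis forces `Tr(α bᵢ) = nᵢ` on the integral basis, the values that
  -- `g / 2π` takes there.
  let α : K := ∑ i, (n i : ℚ) • (integralBasis K).traceDual i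
  have hα : ∀ i, Algebra.trace ℚ K (α * integralBasis K i) = n i := by
    intro i
    simp_rw [α, Finset.sum_mul, map_sum, smul_mul_assoc, map_smul,
      Module.Basis.trace_traceDual_mul]
    simp
  have hcont : Continuous fun r => 2 * Real.pi * absTrace K (algebraMap K _ α * e r) :=
    continuous_const.mul (continuous_absTrace.comp
      (continuous_const.mul (map_continuous e)))
  let g' : (Module.Free.ChooseBasisIndex ℤ (𝓞 K) → ℝ) →L[ℝ] ℝ :=
    (AddMonoidHom.mk' (fun r => 2 * Real.pi * absTrace K (algebraMap K _ α * e r))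
      fun r s => by rw [map_add, mul_add, map_add, mul_add]).toRealLinearMap hcont
  have hgg : g = g' := by
    refine ContinuousLinearMap.coe_injective (LinearMap.pi_ext' fun i => LinearMap.ext_ring ?_)
    change g (Pi.single i 1) = 2 * Real.pi * absTrace K (algebraMap K _ α * e (Pi.single i 1))
    rw [heb, ← map_mul, absTrace_algebraMap, hα, hn]
    simp
  refine ⟨α, fun z => ?_⟩
  obtain ⟨r, rfl⟩ := he z
  have h1 : χ (adeleClass (e r) 0) = Additive.ofMul (Circle.exp (g r)) := hg r
  rw [h1, charMap_adeleClass_zero, hgg]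
  rfl

theorem charMap_surjective : Function.Surjective (charMap K) := by
  intro χ
  let χf : CharGroup (FiniteAdeleRing (𝓞 K) K) :=
    { toFun := fun a => χ (adeleClass 0 a)
      map_zero' := map_zero χ
      map_add' := fun a b => by
        rw [← map_add, ← adeleClass_add, add_zero]
      continuous_toFun := (map_continuous χ).comp
        (continuous_adeleClass.comp (continuous_const.prodMk continuous_id)) }
  obtain ⟨U, hU, hker⟩ := exists_nhds_forall_addSubgroup_le_ker χf
  obtain ⟨d, hd0, hd⟩ := exists_integer_mul_integralAdeles_subset hU
  have hdK : (d : K) ≠ 0 := by simpa using hd0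
  -- `χ` kills the subgroup `d·Ô_K` because it lies in the neighbourhood `U`. The twist by `d` makes
  -- the character trivial on `Ô_K` itself, and it is undone at the end since `d` is invertible in
  -- `K`.
  let χ' : CharGroup (AdeleClassGroup K) := χ.comp (adeleClassMul (d : K))
  have hfin : ∀ a ∈ integralAdeles K, χ' (adeleClass 0 a) = 0 := by
    intro a ha
    change χ (adeleClass (algebraMap K _ (d : K) * 0) (algebraMap K _ (d : K) * a)) = 0
    rw [mul_zero]
    exact hker ((integralAdeles K).map (AddMonoidHom.mulLeft (algebraMap K _ (d : K))))
      (by rintro _ ⟨b, hb, rfl⟩; exact hd b hb) _ ⟨a, ha, rfl⟩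
  have hint : ∀ y : 𝓞 K, χ' (adeleClass (algebraMap K _ (y : K)) 0) = 0 := by
    intro y
    rw [adeleClass_algebraMap_zero, map_neg,
      hfin _ ((algebraMap_mem_integralAdeles_iff _).2 ⟨y, rfl⟩), neg_zero]
  obtain ⟨α, hα⟩ := exists_charMap_eq_on_infiniteAdele χ' hint
  -- The two characters agree on `K_∞`. Both kill `Ô_K`: for `φ_α` this follows because it agrees
  -- with `χ'` on `O_K ⊂ K_∞`.
  have heq : charMap K α = χ' := by
    refine ContinuousAddMonoidHom.ext fun s => ?_
    obtain ⟨z, a, ha, rfl⟩ := exists_adeleClass_eq s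
    rw [adeleClass_eq_add, map_add, map_add, hα, hfin a ha,
      eq_zero_of_mem_integralAdeles (fun y => (hα _).trans (hint y)) ha]
  refine ⟨α * (d : K)⁻¹, ContinuousAddMonoidHom.ext fun s => ?_⟩
  rw [charMap_mul_apply, heq]
  change χ (adeleClassMul (d : K) (adeleClassMul (d : K)⁻¹ s)) = χ s
  rw [← adeleClassMul_mul, mul_inv_cancel₀ hdK, adeleClassMul_one]

theorem charMap_bijective : Function.Bijective (charMap K) :=
  ⟨charMap_injective, charMap_surjective⟩

theorem toTorus_surjective : Function.Surjective (toTorus K) := by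
  intro t
  induction t using QuotientAddGroup.induction_on with
  | H z => exact ⟨adeleClass z 0, toTorus_adeleClass z (zero_mem (integralAdeles K))⟩

theorem comp_toTorus_injective :
    Function.Injective fun χ : CharGroup (MinkowskiTorus K) => χ.comp (toTorus K) := by
  intro χ χ' h
  refine ContinuousAddMonoidHom.ext fun t => ?_
  obtain ⟨s, rfl⟩ := toTorus_surjective t
  exact DFunLike.congr_fun h s

theorem toTorus_adeleClass_zero {a : FiniteAdeleRing (𝓞 K) K} (ha : a ∈ integralAdeles K) :
    toTorus K (adeleClass 0 a) = 0 :=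
  toTorus_adeleClass 0 ha

/-- The elements of the inverse different give characters of the Minkowski torus. -/
theorem exists_comp_toTorus_eq {α : K} (hα : α ∈ inverseDifferent K) :
    ∃ χ : CharGroup (MinkowskiTorus K), χ.comp (toTorus K) = charMap K α := by
  rw [mem_inverseDifferent_iff_charMap] at hα
  let P : InfiniteAdeleRing K →+ Additive Circle := AddMonoidHom.mk'
    (fun z => charMap K α (adeleClass z 0)) fun z w => by
      rw [← map_add, ← adeleClass_add, add_zero]
  have hP : Continuous P := (map_continuous (charMap K α)).comp
    (continuous_adeleClass.comp (continuous_id.prodMk continuous_const))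
  have hker : ∀ x ∈ integerLattice K, P x = 0 := by
    rintro _ ⟨y, rfl⟩
    exact hα y
  let χ : CharGroup (MinkowskiTorus K) := ⟨QuotientAddGroup.lift _ P hker,
    QuotientAddGroup.isOpenQuotientMap_mk.isQuotientMap.continuous_iff.2 hP⟩
  have hχ : ∀ z, χ (QuotientAddGroup.mk z) = charMap K α (adeleClass z 0) := fun _ => rfl
  refine ⟨χ, ContinuousAddMonoidHom.ext fun s => ?_⟩
  obtain ⟨z, a, ha, rfl⟩ := exists_adeleClass_eq s
  rw [char_comp_apply, toTorus_adeleClass z ha, hχ, adeleClass_eq_add z a, map_add,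
    eq_zero_of_mem_integralAdeles hα ha, add_zero]

theorem exists_comp_toTorus_eq_iff (α : K) :
    (∃ χ : CharGroup (MinkowskiTorus K), χ.comp (toTorus K) = charMap K α) ↔
      α ∈ inverseDifferent K := by
  refine ⟨?_, exists_comp_toTorus_eq⟩
  rintro ⟨χ, hχ⟩
  refine mem_inverseDifferent_of_integralAdeles fun a ha => ?_
  rw [← hχ, char_comp_apply, toTorus_adeleClass_zero ha, map_zero]

theorem coe_mem_inverseDifferent (y : 𝓞 K) : (y : K) ∈ inverseDifferent K := by
  rw [mem_inverseDifferent]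
  intro x
  exact ⟨Algebra.trace ℤ (𝓞 K) (y * x), by
    rw [← map_mul, ← Algebra.coe_trace_int]⟩

end NumberFieldCharacters

/-! ### Trace maps: transitivity, surjectivity and naturality of the characters. -/

section Trace

variable {K L M : Type*} [Field K] [NumberField K] [Field L] [NumberField L] [Field M]
  [NumberField M]

theorem trace_relTrace (f : K →+* L) (x : L) :
    Algebra.trace ℚ K (relTrace f x) = Algebra.trace ℚ L x := by
  let := f.toAlgebra
  have : FiniteDimensional K L := Module.Finite.right ℚ K L
  exact Algebra.trace_trace x

theorem relTrace_relTrace (f : K →+* L) (g : L →+* M) (x : M) :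
    relTrace f (relTrace g x) = relTrace (g.comp f) x := by
  let := f.toAlgebra
  let := g.toAlgebra
  let := (g.comp f).toAlgebra
  have : IsScalarTower K L M := IsScalarTower.of_algebraMap_eq fun _ => rfl
  have : FiniteDimensional K L := Module.Finite.right ℚ K L
  have : FiniteDimensional L M := Module.Finite.right ℚ L M
  exact Algebra.trace_trace x

theorem adeleClassTrace_adeleClass (f : K →+* L) (z : InfiniteAdeleRing L)
    (a : FiniteAdeleRing (𝓞 L) L) :
    adeleClassTrace f (adeleClass z a) = adeleClass (infiniteTrace f z) (finiteTrace f a) :=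
  rfl

/-- Both sides are continuous and `L` is dense in `L_∞`, so transitivity of the field trace
suffices. The identities for adelic traces below are reduced to the fields in the same way. -/
theorem absTrace_infiniteTrace (f : K →+* L) (z : InfiniteAdeleRing L) :
    absTrace K (infiniteTrace f z) = absTrace L z := by
  refine (InfiniteAdeleRing.denseRange_algebraMap L).induction_on z ?_ fun x => ?_
  · exact isClosed_eq (continuous_absTrace.comp (map_continuous _)) continuous_absTrace
  · rw [infiniteTrace_algebraMap, absTrace_algebraMap, absTrace_algebraMap, trace_relTrace]

theorem torusChar_torusTrace (f : K →+* L) (t : MinkowskiTorus L) :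
    torusChar K (torusTrace f t) = torusChar L t := by
  induction t using QuotientAddGroup.induction_on with
  | H z =>
    change torusChar K (QuotientAddGroup.mk (infiniteTrace f z)) = _
    rw [torusChar_mk, torusChar_mk, absTrace_infiniteTrace]

theorem infiniteTrace_mul (f : K →+* L) (α : K) (z : InfiniteAdeleRing L) :
    infiniteTrace f (algebraMap L _ (f α) * z) = algebraMap K _ α * infiniteTrace f z := by
  refine (InfiniteAdeleRing.denseRange_algebraMap L).induction_on z ?_ fun x => ?_
  · exact isClosed_eq ((map_continuous _).comp (continuous_const.mul continuous_id))
      (continuous_const.mul (map_continuous _))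
  · rw [← map_mul, infiniteTrace_algebraMap, infiniteTrace_algebraMap, relTrace_mul, map_mul]

theorem finiteTrace_mul (f : K →+* L) (α : K) (a : FiniteAdeleRing (𝓞 L) L) :
    finiteTrace f (algebraMap L _ (f α) * a) = algebraMap K _ α * finiteTrace f a := by
  refine denseRange_finiteAdele.induction_on a ?_ fun x => ?_
  · exact isClosed_eq ((map_continuous _).comp (continuous_const.mul continuous_id))
      (continuous_const.mul (map_continuous _))
  · rw [← map_mul, finiteTrace_algebraMap, finiteTrace_algebraMap, relTrace_mul, map_mul]

theorem adeleClassTrace_mul (f : K →+* L) (α : K) (s : AdeleClassGroup L) :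
    adeleClassTrace f (adeleClassMul (f α) s) = adeleClassMul α (adeleClassTrace f s) := by
  obtain ⟨z, a, rfl⟩ := exists_adeleClass_eq' s
  rw [adeleClassMul_adeleClass, adeleClassTrace_adeleClass, adeleClassTrace_adeleClass,
    adeleClassMul_adeleClass, infiniteTrace_mul, finiteTrace_mul]

/-- This combines the projection formula `Tr(α s) = α Tr(s)`, the compatibility of the traces with
the projections to the tori, and the transitivity of the trace down to `ℚ`. -/
theorem charMap_comp_adeleClassTrace (f : K →+* L) (α : K) :
    charMap L (f α) = (charMap K α).comp (adeleClassTrace f) := by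
  refine ContinuousAddMonoidHom.ext fun s => ?_
  rw [char_comp_apply, charMap_apply, charMap_apply, ← adeleClassTrace_mul, ← torusTrace_toTorus,
    torusChar_torusTrace]

theorem infiniteTrace_infiniteTrace (f : K →+* L) (g : L →+* M) (z : InfiniteAdeleRing M) :
    infiniteTrace f (infiniteTrace g z) = infiniteTrace (g.comp f) z := by
  refine (InfiniteAdeleRing.denseRange_algebraMap M).induction_on z ?_ fun x => ?_
  · exact isClosed_eq ((map_continuous _).comp (map_continuous _)) (map_continuous _)
  · simp only [infiniteTrace_algebraMap, relTrace_relTrace]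

theorem finiteTrace_finiteTrace (f : K →+* L) (g : L →+* M) (a : FiniteAdeleRing (𝓞 M) M) :
    finiteTrace f (finiteTrace g a) = finiteTrace (g.comp f) a := by
  refine denseRange_finiteAdele.induction_on a ?_ fun x => ?_
  · exact isClosed_eq ((map_continuous _).comp (map_continuous _)) (map_continuous _)
  · simp only [finiteTrace_algebraMap, relTrace_relTrace]

theorem adeleClassTrace_adeleClassTrace (f : K →+* L) (g : L →+* M) (s : AdeleClassGroup M) :
    adeleClassTrace f (adeleClassTrace g s) = adeleClassTrace (g.comp f) s := by
  obtain ⟨z, a, rfl⟩ := exists_adeleClass_eq' s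
  simp only [adeleClassTrace_adeleClass, infiniteTrace_infiniteTrace, finiteTrace_finiteTrace]

theorem relTrace_surjective (f : K →+* L) : Function.Surjective (relTrace f) := by
  let := f.toAlgebra
  have : FiniteDimensional K L := Module.Finite.right ℚ K L
  exact Algebra.trace_surjective K L

variable (K) in
/-- The image of `K ⊆ K_∞` is dense in the adele class group. -/
theorem denseRange_adeleClass_algebraMap_zero :
    DenseRange fun x : K => adeleClass (algebraMap K (InfiniteAdeleRing K) x) 0 := by
  have h1 : ∀ z : InfiniteAdeleRing K, adeleClass z 0 ∈ closure (Set.range fun x : K =>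
      adeleClass (algebraMap K (InfiniteAdeleRing K) x) 0) := by
    intro z
    refine (InfiniteAdeleRing.denseRange_algebraMap K).induction_on z ?_ fun x =>
      subset_closure ⟨x, rfl⟩
    exact isClosed_closure.preimage
      (continuous_adeleClass.comp (continuous_id.prodMk continuous_const))
  intro s
  obtain ⟨z, a, rfl⟩ := exists_adeleClass_eq' s
  refine denseRange_finiteAdele.induction_on (p := fun a => adeleClass z a ∈ closure (Set.range
    fun x : K => adeleClass (algebraMap K (InfiniteAdeleRing K) x) 0)) a ?_ fun x => ?_
  · exact isClosed_closure.preimage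
      (continuous_adeleClass.comp (continuous_const.prodMk continuous_id))
  -- Subtracting the principal adele `x` clears a finite component that lies in `K`.
  · have : adeleClass z (algebraMap K _ x) = adeleClass (z - algebraMap K _ x) 0 := by
      have h := adeleClass_add (z - algebraMap K _ x) (algebraMap K _ x) 0 (algebraMap K _ x)
      rwa [sub_add_cancel, zero_add, adeleClass_algebraMap, add_zero] at h
    rw [this]
    exact h1 _

/-- The image is compact, hence closed, and it contains the dense image of `K ⊂ K_∞` because the
field trace `L → K` is onto. -/
theorem adeleClassTrace_surjective (f : K →+* L) : Function.Surjective (adeleClassTrace f) := by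
  rw [← Set.range_eq_univ,
    ← (isCompact_range (map_continuous (adeleClassTrace f))).isClosed.closure_eq,
    ← dense_iff_closure_eq]
  refine (denseRange_adeleClass_algebraMap_zero K).mono ?_
  rintro _ ⟨x, rfl⟩
  obtain ⟨y, rfl⟩ := relTrace_surjective f x
  refine ⟨adeleClass (algebraMap L _ y) 0, ?_⟩
  rw [adeleClassTrace_adeleClass, infiniteTrace_algebraMap, map_zero]

/-- For integral `y`, `Tr_L(α y) = Tr_K(α Tr_{L/K}(y))`, and `Tr_{L/K}(y)` is again integral. -/
theorem mem_inverseDifferent_map (f : K →+* L) {α : K} (hα : α ∈ inverseDifferent K) :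
    f α ∈ inverseDifferent L := by
  rw [mem_inverseDifferent] at hα ⊢
  intro y
  obtain ⟨x, hx⟩ := relTrace_integral f (y : L) ⟨y, rfl⟩
  obtain ⟨n, hn⟩ := hα x
  refine ⟨n, ?_⟩
  rw [← trace_relTrace f, relTrace_mul, ← hx]
  exact hn

end Trace

/-! ### Transport of the field structure along a bijection. -/

section FieldStructure

theorem makesField_of_bijective {A X : Type*} [Field A] [AddCommGroup X] (e : A → X)
    (he : Function.Bijective e)
    (hadd : ∀ a b, e (a + b) = e a + e b) (otimes : X → X → X)
    (hmul : ∀ a b, e (a * b) = otimes (e a) (e b)) : MakesField otimes := by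
  let E := Equiv.ofBijective e he
  refine ⟨E.symm.field, fun x y => ?_, fun x y => ?_⟩
  · change E (E.symm x + E.symm y) = x + y
    refine (hadd _ _).trans ?_
    exact congrArg₂ _ (E.apply_symm_apply x) (E.apply_symm_apply y)
  · change E (E.symm x * E.symm y) = otimes x y
    refine (hmul _ _).trans ?_
    exact congrArg₂ _ (E.apply_symm_apply x) (E.apply_symm_apply y)

theorem exists_transported_mul {A X : Type*} [Mul A] (e : A → X) (he : Function.Bijective e) :
    ∃ otimes : X → X → X, ∀ a b, e (a * b) = otimes (e a) (e b) := by
  let E := Equiv.ofBijective e he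
  refine ⟨fun x y => e (E.symm x * E.symm y), fun a b => ?_⟩
  have h : ∀ c, E.symm (e c) = c := E.symm_apply_apply
  simp only [h]

/-- If the values of `e` at algebraic integers lie in a subgroup, then `e` restricts to an
embedding of the ring of integers that respects the transported multiplication. -/
theorem exists_integer_embedding {A X Y : Type*} [Field A] [AddCommGroup X] [AddCommGroup Y]
    (e : A → X) (he : Function.Bijective e) (hadd : ∀ a b, e (a + b) = e a + e b)
    (otimes : X → X → X) (hmul : ∀ a b, e (a * b) = otimes (e a) (e b))
    (c : Y → X) (hc : Function.Injective c) (hcadd : ∀ x y, c (x + y) = c x + c y)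
    (h : ∀ a : 𝓞 A, ∃ y, c y = e (a : A)) :
    ∃ j : 𝓞 A →+ Y, Function.Injective j ∧ (∀ a : 𝓞 A, c (j a) = e (a : A)) ∧
      (∀ a b : 𝓞 A, c (j (a * b)) = otimes (c (j a)) (c (j b))) ∧
      ∀ χ, otimes (c (j 1)) χ = χ := by
  choose j hj using h
  refine ⟨AddMonoidHom.mk' j fun a b => hc ?_, fun a b hab => ?_, hj, fun a b => ?_,
    fun χ => ?_⟩
  · rw [hcadd, hj, hj, hj]
    exact hadd _ _
  · refine RingOfIntegers.ext (he.1 ?_)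
    rw [← hj, ← hj]
    exact congrArg c hab
  · change c (j (a * b)) = otimes (c (j a)) (c (j b))
    rw [hj, hj, hj]
    exact hmul _ _
  · obtain ⟨β, rfl⟩ := he.2 χ
    change otimes (c (j 1)) _ = _
    rw [hj, ← hmul]
    exact congrArg e (one_mul β)

end FieldStructure

/-! ### Part (a), and preparations for inverse limits. -/

theorem numberField_characters (K : Type*) [Field K] [NumberField K] :
    ∃ otimes : CharGroup (AdeleClassGroup K) → CharGroup (AdeleClassGroup K) → CharGroup (AdeleClassGroup K),
      MakesField otimes ∧
      Function.Bijective (charMap K) ∧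
      (∀ α β : K, charMap K (α + β) = charMap K α + charMap K β) ∧
      (∀ α β : K, charMap K (α * β) = otimes (charMap K α) (charMap K β)) ∧
      (∀ (α : K) (z : InfiniteAdeleRing K),
        charVal (charMap K α) (adeleClass z 0) =
          Complex.exp (2 * Real.pi * Complex.I * absTrace K (algebraMap K _ α * z))) ∧
      (∀ (L : Type*) [Field L] [NumberField L] (f : K →+* L) (α : K),
        charMap L (f α) = (charMap K α).comp (adeleClassTrace f)) ∧
      Function.Injective
        (fun χ : CharGroup (MinkowskiTorus K) => χ.comp (toTorus K)) ∧
      (∀ α : K, (∃ χ : CharGroup (MinkowskiTorus K), χ.comp (toTorus K) = charMap K α) ↔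
        α ∈ inverseDifferent K) ∧
      (∃ j : 𝓞 K →+ CharGroup (MinkowskiTorus K),
        Function.Injective j ∧
        (∀ a : 𝓞 K, (j a).comp (toTorus K) = charMap K (a : K)) ∧
        (∀ a b : 𝓞 K, (j (a * b)).comp (toTorus K) =
          otimes ((j a).comp (toTorus K)) ((j b).comp (toTorus K))) ∧
        ∀ χ, otimes ((j 1).comp (toTorus K)) χ = χ) := by
  obtain ⟨otimes, hmul⟩ := exists_transported_mul (charMap K) charMap_bijective
  refine ⟨otimes, makesField_of_bijective _ charMap_bijective charMap_add _ hmul,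
    charMap_bijective, charMap_add, hmul, fun α z => ?_,
    fun L _ _ f α => charMap_comp_adeleClassTrace f α, comp_toTorus_injective,
    exists_comp_toTorus_eq_iff, ?_⟩
  · rw [charVal, charMap_adeleClass_zero, toMul_ofMul, Circle.coe_exp]
    congr 1
    push_cast
    ring
  · exact exists_integer_embedding _ charMap_bijective charMap_add _ hmul _ comp_toTorus_injective
      (fun _ _ => rfl) fun a => exists_comp_toTorus_eq (coe_mem_inverseDifferent a)

/-- The fibres of the projection to the Minkowski torus are translates of the compact image of
the integral finite adeles. -/
theorem isCompact_toTorus_preimage {K : Type*} [Field K] [NumberField K] (t : MinkowskiTorus K) :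
    IsCompact (toTorus K ⁻¹' {t}) := by
  induction t using QuotientAddGroup.induction_on with
  | H z =>
    have hc : Continuous fun a : FiniteAdeleRing (𝓞 K) K => adeleClass z a :=
      continuous_adeleClass.comp (continuous_const.prodMk continuous_id)
    convert (isCompact_integralAdeles (K := K)).image hc
    ext s
    constructor
    · obtain ⟨w, b, hb, rfl⟩ := exists_adeleClass_eq s
      intro h
      rw [Set.mem_preimage, toTorus_adeleClass w hb, Set.mem_singleton_iff, QuotientAddGroup.eq]
        at h
      obtain ⟨y, hy⟩ := h
      have hy' : algebraMap K (InfiniteAdeleRing K) (y : K) = -w + z := hy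
      -- Here `z = w + y` with `y ∈ O_K`, so adding the principal adele `y` changes `w` into `z` and
      -- keeps the finite component integral.
      refine ⟨b + algebraMap K _ (y : K), add_mem hb
        ((algebraMap_mem_integralAdeles_iff _).2 ⟨y, rfl⟩), ?_⟩
      have h1 := adeleClass_add w (algebraMap K _ (y : K)) b (algebraMap K _ (y : K))
      rw [adeleClass_algebraMap, add_zero, hy', add_neg_cancel_left] at h1
      exact h1
    · rintro ⟨a, ha, rfl⟩
      exact toTorus_adeleClass z ha

/-- A character of an inverse limit of groups is trivial on the kernel of the projection to
a sufficiently high level. -/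
theorem exists_level_of_char {ι : Type*} [Preorder ι] [IsDirectedOrder ι] {X : ι → Type*}
    [∀ i, AddCommGroup (X i)] [∀ i, TopologicalSpace (X i)] (P : AddSubgroup (∀ i, X i))
    (hP : ∀ s ∈ P, ∀ i j, i ≤ j → s j = 0 → s i = 0) (χ : CharGroup P) (i₀ : ι) :
    ∃ k, i₀ ≤ k ∧ ∀ s : P, s.1 k = 0 → χ s = 0 := by
  have : Nonempty ι := ⟨i₀⟩
  obtain ⟨U, hU, h⟩ := exists_nhds_forall_addSubgroup_le_ker χ
  rw [nhds_subtype_eq_comap, Filter.mem_comap] at hU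
  obtain ⟨V, hV, hVU⟩ := hU
  rw [ZeroMemClass.coe_zero, nhds_pi, Filter.mem_pi] at hV
  obtain ⟨I, hI, t, ht, hsub⟩ := hV
  -- The neighbourhood restricts only the coordinates in the finite set `I`. At a level `k` above
  -- all of them, `s k = 0` makes these coordinates zero, so the kernel of the projection to level
  -- `k` is a subgroup inside the neighbourhood.
  obtain ⟨k₀, hk₀⟩ := hI.bddAbove
  obtain ⟨k, hk, hik⟩ := exists_ge_ge k₀ i₀
  refine ⟨k, hik, fun s hs => h (((Pi.evalAddMonoidHom X k).comp P.subtype).ker) ?_ s hs⟩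
  intro x hx
  refine hVU (hsub fun i hi => ?_)
  rw [hP x.1 x.2 i k ((hk₀ hi).trans hk) hx]
  exact mem_of_mem_nhds (ht i)

/-! ### Number fields inside a directed union. -/

section Union

/-- A number field embeds in a stage of every directed union that contains it. -/
theorem exists_forall_mem_of_directed {E κ : Type*} [Field E] [Preorder κ] [IsDirectedOrder κ]
    (G : κ → Subfield E) [∀ j, NumberField (G j)] (hG : Monotone G) (hcov : ∀ x : E, ∃ j, x ∈ G j)
    {M : Type*} [Field M] [NumberField M] (f : M →+* E) : ∃ j, ∀ x, f x ∈ G j := by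
  let b := Module.finBasis ℚ M
  have : Nonempty κ := ⟨(hcov 0).choose⟩
  choose c hc using fun l => hcov (f (b l))
  obtain ⟨j, hj⟩ := (Set.finite_range c).bddAbove
  refine ⟨j, fun x => ?_⟩
  rw [← b.sum_repr x, map_sum]
  refine sum_mem fun l _ => ?_
  rw [Algebra.smul_def, map_mul]
  refine mul_mem ?_ (hG (hj ⟨l, rfl⟩) (hc l))
  -- There is at most one homomorphism from `ℚ` to a field, so rational scalars lie in every `G j`.
  have h : f.comp (algebraMap ℚ M) = (G j).subtype.comp (algebraMap ℚ (G j)) :=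
    Subsingleton.elim _ _
  have h' := RingHom.congr_fun h (b.repr x l)
  rw [RingHom.comp_apply] at h'
  rw [h']
  exact Subtype.property _

end Union

/-! ### Characters of the proto adele class group and of the proto torus. -/

section ProtoCharacters

variable {E ι : Type*} [Field E] [Preorder ι] (F : ι → Subfield E) [∀ i, NumberField (F i)]
  (hF : Monotone F)

instance : CompactSpace (protoAdeleClassGroup F hF) := by
  refine isCompact_iff_compactSpace.1 (IsClosed.isCompact (s := SetLike.coe _) ?_)
  change IsClosed {s : ∀ i, AdeleClassGroup (F i) |
    ∀ i j (h : i ≤ j), adeleClassTrace (Subfield.inclusion (hF h)) (s j) = s i}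
  simp only [Set.ofPred_forall]
  exact isClosed_iInter fun i => isClosed_iInter fun j => isClosed_iInter fun h =>
    isClosed_eq ((map_continuous _).comp (continuous_apply j)) (continuous_apply i)

theorem adeleClassTrace_inclusion {i j k : ι} (hij : i ≤ j) (hjk : j ≤ k)
    (s : AdeleClassGroup (F k)) :
    adeleClassTrace (Subfield.inclusion (hF hij))
      (adeleClassTrace (Subfield.inclusion (hF hjk)) s) =
      adeleClassTrace (Subfield.inclusion (hF (hij.trans hjk))) s :=
  adeleClassTrace_adeleClassTrace _ _ s

theorem protoProj_surjective [IsDirectedOrder ι] (k : ι) :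
    Function.Surjective (protoProj F hF k) := by
  intro s
  obtain ⟨x, hx, hcomp⟩ := exists_forall_mem_of_isCompact
    (fun i j (h : i ≤ j) => adeleClassTrace (Subfield.inclusion (hF h)))
    (fun i j h => map_continuous _)
    (fun i j k hij hjk x => adeleClassTrace_inclusion F hF hij hjk x)
    -- The condition to lie over `s` is imposed only at levels above `k`. Elsewhere the set is the
    -- whole compact group, and surjectivity of the traces makes it nonempty at every level.
    (fun i => {x : AdeleClassGroup (F i) |
      ∀ h : k ≤ i, adeleClassTrace (Subfield.inclusion (hF h)) x = s})
    (fun i => by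
      refine IsClosed.isCompact ?_
      simp only [Set.ofPred_forall]
      exact isClosed_iInter fun h => isClosed_eq (map_continuous _) continuous_const)
    (fun i => by
      by_cases h : k ≤ i
      · obtain ⟨x, hx⟩ := adeleClassTrace_surjective (Subfield.inclusion (hF h)) s
        exact ⟨x, fun _ => hx⟩
      · exact ⟨0, fun h' => absurd h' h⟩)
    (fun i j h x hx hki => by
      rw [adeleClassTrace_inclusion F hF hki h]
      exact hx (hki.trans h))
  exact ⟨⟨x, hcomp⟩, (hcomp k k le_rfl).symm.trans (hx k le_rfl)⟩

/-- Surjectivity at each level does not pass to an inverse limit by itself; it does here because the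
fibres of `Ŝ → 𝕋` are compact. Composition with `p̂` is injective on characters for this reason. -/
theorem protoToTorus_surjective [IsDirectedOrder ι] : Function.Surjective (protoToTorus F hF) := by
  intro t
  obtain ⟨x, hx, hcomp⟩ := exists_forall_mem_of_isCompact
    (fun i j (h : i ≤ j) => adeleClassTrace (Subfield.inclusion (hF h)))
    (fun i j h => map_continuous _)
    (fun i j k hij hjk x => adeleClassTrace_inclusion F hF hij hjk x)
    (fun i => toTorus (F i) ⁻¹' {t.1 i}) (fun i => isCompact_toTorus_preimage _)
    (fun i => toTorus_surjective (t.1 i))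
    (fun i j h x (hx : toTorus (F j) x = t.1 j) => by
      rw [Set.mem_preimage, ← torusTrace_toTorus, hx]
      exact t.2 i j h)
  exact ⟨⟨x, hcomp⟩, Subtype.ext (funext hx)⟩

theorem adeleClassTrace_protoProj {i j : ι} (h : i ≤ j) (s : protoAdeleClassGroup F hF) :
    adeleClassTrace (Subfield.inclusion (hF h)) (protoProj F hF j s) = protoProj F hF i s :=
  s.2 i j h

/-- Both sides are the trace from a common higher level, so the map from the limit to the class
group of `M` does not depend on the level used to compute it. -/
theorem adeleClassTrace_restrict_eq {E E' κ : Type*} [Field E] [Field E'] [Preorder κ]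
    [IsDirectedOrder κ] (G : κ → Subfield E') [∀ j, NumberField (G j)] (hG : Monotone G)
    (M : Subfield E) [NumberField M] (f : E →+* E') {j j' : κ}
    (h : ∀ x ∈ M, f x ∈ G j) (h' : ∀ x ∈ M, f x ∈ G j') (s : protoAdeleClassGroup G hG) :
    adeleClassTrace (f.restrict (M) (G j) h) (protoProj G hG j s) =
      adeleClassTrace (f.restrict (M) (G j') h') (protoProj G hG j' s) := by
  obtain ⟨k, hk, hk'⟩ := exists_ge_ge j j'
  rw [← adeleClassTrace_protoProj G hG hk, ← adeleClassTrace_protoProj G hG hk',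
    adeleClassTrace_adeleClassTrace, adeleClassTrace_adeleClassTrace]
  rfl

theorem charMap_comp_protoProj {i j : ι} (h : i ≤ j) (α : F i) :
    (charMap (F j) (Subfield.inclusion (hF h) α)).comp (protoProj F hF j) =
      (charMap (F i) α).comp (protoProj F hF i) := by
  refine ContinuousAddMonoidHom.ext fun s => ?_
  rw [charMap_comp_adeleClassTrace, char_comp_apply, char_comp_apply, char_comp_apply,
    adeleClassTrace_protoProj]

variable (hcov : ∀ x : E, ∃ i, x ∈ F i)

/-- The level chosen in `protoCharMap` is immaterial: two levels are compared at a common upper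
bound by naturality under the trace. -/
theorem protoCharMap_coe [IsDirectedOrder ι] (i : ι) (α : F i) :
    protoCharMap F hF hcov (α : E) = (charMap (F i) α).comp (protoProj F hF i) := by
  obtain ⟨k, hk, hik⟩ := exists_ge_ge (hcov (α : E)).choose i
  rw [← charMap_comp_protoProj F hF hik, protoCharMap, ← charMap_comp_protoProj F hF hk]
  rfl

theorem exists_common_level {E ι : Type*} [Field E] [Preorder ι] [IsDirectedOrder ι]
    (F : ι → Subfield E) (hcov : ∀ x : E, ∃ i, x ∈ F i) (hF : Monotone F) (α β : E) :
    ∃ i, ∃ a b : F i, (a : E) = α ∧ (b : E) = β := by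
  obtain ⟨i, hi⟩ := hcov α
  obtain ⟨j, hj⟩ := hcov β
  obtain ⟨k, hik, hjk⟩ := exists_ge_ge i j
  exact ⟨k, ⟨α, hF hik hi⟩, ⟨β, hF hjk hj⟩, rfl, rfl⟩

theorem protoCharMap_add [IsDirectedOrder ι] (α β : E) :
    protoCharMap F hF hcov (α + β) = protoCharMap F hF hcov α + protoCharMap F hF hcov β := by
  obtain ⟨i, a, b, rfl, rfl⟩ := exists_common_level F hcov hF α β
  rw [← Subfield.coe_add, protoCharMap_coe, protoCharMap_coe, protoCharMap_coe, charMap_add]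
  rfl

theorem comp_injective_of_surjective {G H : Type*} [AddCommGroup G] [TopologicalSpace G]
    [AddCommGroup H] [TopologicalSpace H] {p : G →ₜ+ H} (hp : Function.Surjective p) :
    Function.Injective fun χ : CharGroup H => χ.comp p := by
  intro χ χ' h
  refine ContinuousAddMonoidHom.ext fun t => ?_
  obtain ⟨s, rfl⟩ := hp t
  exact DFunLike.congr_fun h s

theorem protoCharMap_injective [IsDirectedOrder ι] :
    Function.Injective (protoCharMap F hF hcov) := by
  intro α β h
  obtain ⟨i, a, b, rfl, rfl⟩ := exists_common_level F hcov hF α β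
  rw [protoCharMap_coe, protoCharMap_coe] at h
  rw [charMap_injective (comp_injective_of_surjective (protoProj_surjective F hF i) h)]

/-- A character trivial on the kernel of a surjective projection descends as a homomorphism. The
descended map is continuous because a continuous surjection from a compact space to a Hausdorff
space is a quotient map. -/
theorem exists_char_level [IsDirectedOrder ι] (χ : CharGroup (protoAdeleClassGroup F hF))
    (i₀ : ι) : ∃ k, ∃ ψ : CharGroup (AdeleClassGroup (F k)), i₀ ≤ k ∧
      ψ.comp (protoProj F hF k) = χ := by
  obtain ⟨k, hk, hker⟩ := exists_level_of_char (protoAdeleClassGroup F hF)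
    (fun s hs i j h hj => by rw [← hs i j h, hj, map_zero]) χ i₀
  have hsurj := protoProj_surjective F hF k
  have hle : (protoProj F hF k).toAddMonoidHom.ker ≤ χ.toAddMonoidHom.ker := fun s hs => hker s hs
  let ψ : AdeleClassGroup (F k) →+ Additive Circle :=
    (protoProj F hF k).toAddMonoidHom.liftOfSurjective hsurj ⟨χ.toAddMonoidHom, hle⟩
  have hψ : ∀ s, ψ (protoProj F hF k s) = χ s :=
    AddMonoidHom.liftOfRightInverse_comp_apply _ _ _ ⟨χ.toAddMonoidHom, hle⟩
  have hq : IsQuotientMap (protoProj F hF k) :=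
    (map_continuous (protoProj F hF k)).isClosedMap.isQuotientMap (map_continuous _) hsurj
  have hc : Continuous ψ := hq.continuous_iff.2 ((map_continuous χ).congr fun s => (hψ s).symm)
  exact ⟨k, ⟨ψ, hc⟩, hk, ContinuousAddMonoidHom.ext hψ⟩

theorem protoCharMap_surjective [IsDirectedOrder ι] :
    Function.Surjective (protoCharMap F hF hcov) := by
  intro χ
  obtain ⟨k, ψ, -, rfl⟩ := exists_char_level F hF χ (hcov 0).choose
  obtain ⟨α, rfl⟩ := charMap_surjective ψ
  exact ⟨α, protoCharMap_coe F hF hcov k α⟩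

theorem protoCharMap_bijective [IsDirectedOrder ι] :
    Function.Bijective (protoCharMap F hF hcov) :=
  ⟨protoCharMap_injective F hF hcov, protoCharMap_surjective F hF hcov⟩

/-- The projection of the proto torus to a finite level. -/
noncomputable def protoTorusProj (i : ι) : protoTorus F hF →ₜ+ MinkowskiTorus (F i) where
  toFun s := s.1 i
  map_zero' := rfl
  map_add' _ _ := rfl
  continuous_toFun := (continuous_apply i).comp continuous_subtype_val

theorem exists_comp_protoToTorus_eq_iff [IsDirectedOrder ι] (α : E) :
    (∃ χ : CharGroup (protoTorus F hF),
      χ.comp (protoToTorus F hF) = protoCharMap F hF hcov α) ↔ α ∈ limitInverseDifferent E := by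
  constructor
  · rintro ⟨χ, hχ⟩
    obtain ⟨i, hi⟩ := hcov α
    obtain ⟨k, hk, hker⟩ := exists_level_of_char (protoTorus F hF)
      (fun s hs i j h hj => by rw [← hs i j h, hj, map_zero]) χ i
    let a : F k := ⟨α, hF hk hi⟩
    refine ⟨F k, inferInstance, a, mem_inverseDifferent_of_integralAdeles fun b hb => ?_, rfl⟩
    -- Lifting an integral finite adele of level `k` to the proto class group gives a point of the
    -- proto torus with zero `k`-th coordinate, which `χ` kills. Hence `φ_a` kills `Ô` at level `k`,
    -- without descending `χ` to a torus of finite level.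
    obtain ⟨s, hs⟩ := protoProj_surjective F hF k (adeleClass 0 b)
    rw [← hs, ← char_comp_apply, ← protoCharMap_coe F hF hcov k a, ← hχ, char_comp_apply]
    refine hker _ ?_
    change toTorus (F k) (protoProj F hF k s) = 0
    rw [hs, toTorus_adeleClass_zero hb]
  · rintro ⟨M, _, x, hx, rfl⟩
    -- `M` need not belong to the directed system, but some `F i` contains it, and inverse
    -- differents grow with the field.
    obtain ⟨i, hi⟩ := exists_forall_mem_of_directed F hF hcov M.subtype
    have hle : M ≤ F i := fun y hy => hi ⟨y, hy⟩
    obtain ⟨χ, hχ⟩ := exists_comp_toTorus_eq (mem_inverseDifferent_map (Subfield.inclusion hle) hx)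
    refine ⟨χ.comp (protoTorusProj F hF i), ?_⟩
    refine Eq.trans ?_ (protoCharMap_coe F hF hcov i (Subfield.inclusion hle x)).symm
    rw [← hχ]
    rfl

theorem coe_mem_limitInverseDifferent {E ι : Type*} [Field E] (F : ι → Subfield E)
    [∀ i, NumberField (F i)] (hcov : ∀ x : E, ∃ i, x ∈ F i) (a : 𝓞 E) :
    (a : E) ∈ limitInverseDifferent E := by
  obtain ⟨i, hi⟩ := hcov (a : E)
  have hint : IsIntegral ℤ (⟨a, hi⟩ : F i) := by
    rw [← isIntegral_algHom_iff ((F i).subtype.toIntAlgHom) Subtype.val_injective]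
    exact RingOfIntegers.isIntegral_coe a
  exact ⟨F i, inferInstance, ⟨a, hi⟩, coe_mem_inverseDifferent ⟨_, hint⟩, rfl⟩

variable {E' κ : Type*} [Field E'] [Preorder κ] (G : κ → Subfield E') [∀ j, NumberField (G j)]
  (hG : Monotone G)

theorem adeleClassTrace_restrict_of_le (f : E →+* E') {i i' : ι} {j j' : κ} (hi : i ≤ i')
    (hj : j ≤ j') (h : ∀ x ∈ F i, f x ∈ G j) (h' : ∀ x ∈ F i', f x ∈ G j')
    (s : protoAdeleClassGroup G hG) :
    adeleClassTrace (Subfield.inclusion (hF hi))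
      (adeleClassTrace (f.restrict (F i') (G j') h') (protoProj G hG j' s)) =
      adeleClassTrace (f.restrict (F i) (G j) h) (protoProj G hG j s) := by
  rw [← adeleClassTrace_protoProj G hG hj, adeleClassTrace_adeleClassTrace,
    adeleClassTrace_adeleClassTrace]
  rfl

/-- Each `f(F i)` lies in some `G (c i)`, and the trace from that level defines the `i`-th
coordinate; independence of the level makes the coordinates compatible. -/
theorem exists_protoTrace [IsDirectedOrder ι] [IsDirectedOrder κ] (hcov' : ∀ x : E', ∃ j, x ∈ G j)
    (f : E →+* E') :
    ∃ T : protoAdeleClassGroup G hG →ₜ+ protoAdeleClassGroup F hF,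
      (∀ (i : ι) (j : κ) (h : ∀ x ∈ F i, f x ∈ G j) (s : protoAdeleClassGroup G hG),
        protoProj F hF i (T s) =
          adeleClassTrace (f.restrict (F i) (G j) h) (protoProj G hG j s)) ∧
      ∀ α : E, protoCharMap G hG hcov' (f α) = (protoCharMap F hF hcov α).comp T := by
  have hex : ∀ i, ∃ j, ∀ x ∈ F i, f x ∈ G j := fun i => by
    obtain ⟨j, hj⟩ := exists_forall_mem_of_directed G hG hcov' (f.comp (F i).subtype)
    exact ⟨j, fun x hx => hj ⟨x, hx⟩⟩
  choose c hc using hex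
  let t : ∀ i, protoAdeleClassGroup G hG →ₜ+ AdeleClassGroup (F i) := fun i =>
    (adeleClassTrace (f.restrict (F i) (G (c i)) (hc i))).comp (protoProj G hG (c i))
  have ht : ∀ (i : ι) (j : κ) (h : ∀ x ∈ F i, f x ∈ G j) (s : protoAdeleClassGroup G hG),
      t i s = adeleClassTrace (f.restrict (F i) (G j) h) (protoProj G hG j s) :=
    fun i j h s => adeleClassTrace_restrict_eq G hG (F i) f _ _ s
  let T : protoAdeleClassGroup G hG →ₜ+ protoAdeleClassGroup F hF :=
    { toFun := fun s => ⟨fun i => t i s, fun i j h => by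
        -- The level `c j` also serves for `i ≤ j`, so both coordinates are computed from it and
        -- transitivity of the trace applies.
        refine Eq.trans ?_ (ht i (c j) (fun x hx => hc j x (hF h hx)) s).symm
        exact adeleClassTrace_restrict_of_le F hF G hG f h le_rfl _ _ s⟩
      map_zero' := Subtype.ext (funext fun i => map_zero (t i))
      map_add' := fun s s' => Subtype.ext (funext fun i => map_add (t i) s s')
      continuous_toFun := Continuous.subtype_mk
        (continuous_pi fun i => map_continuous (t i)) _ }
  refine ⟨T, ht, fun α => ?_⟩
  obtain ⟨i, hi⟩ := hcov α
  have h1 := protoCharMap_coe G hG hcov' (c i) (f.restrict (F i) (G (c i)) (hc i) ⟨α, hi⟩)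
  have h2 := protoCharMap_coe F hF hcov i ⟨α, hi⟩
  refine h1.trans ?_
  rw [charMap_comp_adeleClassTrace]
  exact (congrArg (fun χ => ContinuousAddMonoidHom.comp χ T) h2).symm

end ProtoCharacters

end AdeleChar

/-! ### The theorem: both parts assembled. -/

open AdeleChar in
theorem mainTheorem4 :
    -- (a) number fields
    (∀ (K : Type*) [Field K] [NumberField K],
      ∃ otimes : CharGroup (AdeleClassGroup K) → CharGroup (AdeleClassGroup K) → CharGroup (AdeleClassGroup K),
        MakesField otimes ∧
        Function.Bijective (charMap K) ∧
        (∀ α β : K, charMap K (α + β) = charMap K α + charMap K β) ∧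
        (∀ α β : K, charMap K (α * β) = otimes (charMap K α) (charMap K β)) ∧
        (∀ (α : K) (z : InfiniteAdeleRing K),
          charVal (charMap K α) (adeleClass z 0) =
            Complex.exp (2 * Real.pi * Complex.I * absTrace K (algebraMap K _ α * z))) ∧
        (∀ (L : Type*) [Field L] [NumberField L] (f : K →+* L) (α : K),
          charMap L (f α) = (charMap K α).comp (adeleClassTrace f)) ∧
        Function.Injective
          (fun χ : CharGroup (MinkowskiTorus K) => χ.comp (toTorus K)) ∧
        (∀ α : K, (∃ χ : CharGroup (MinkowskiTorus K), χ.comp (toTorus K) = charMap K α) ↔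
          α ∈ inverseDifferent K) ∧
        (∃ j : 𝓞 K →+ CharGroup (MinkowskiTorus K),
          Function.Injective j ∧
          (∀ a : 𝓞 K, (j a).comp (toTorus K) = charMap K (a : K)) ∧
          (∀ a b : 𝓞 K, (j (a * b)).comp (toTorus K) =
            otimes ((j a).comp (toTorus K)) ((j b).comp (toTorus K))) ∧
          ∀ χ, otimes ((j 1).comp (toTorus K)) χ = χ)) ∧
    -- (b) unions of directed systems of number fields
    (∀ (E : Type*) [Field E] (ι : Type*) [Preorder ι] [IsDirectedOrder ι] (F : ι → Subfield E)
      [∀ i, NumberField (F i)] (hF : Monotone F) (hcov : ∀ x : E, ∃ i, x ∈ F i),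
      ∃ otimes : CharGroup (protoAdeleClassGroup F hF) → CharGroup (protoAdeleClassGroup F hF) →
          CharGroup (protoAdeleClassGroup F hF),
        MakesField otimes ∧
        Function.Bijective (protoCharMap F hF hcov) ∧
        (∀ α β : E, protoCharMap F hF hcov (α + β) =
          protoCharMap F hF hcov α + protoCharMap F hF hcov β) ∧
        (∀ α β : E, protoCharMap F hF hcov (α * β) =
          otimes (protoCharMap F hF hcov α) (protoCharMap F hF hcov β)) ∧
        (∀ (i : ι) (α : F i), protoCharMap F hF hcov (α : E) =
          (charMap (F i) α).comp (protoProj F hF i)) ∧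
        (∀ (E' : Type*) [Field E'] (κ : Type*) [Preorder κ] [IsDirectedOrder κ]
          (G : κ → Subfield E') [∀ j, NumberField (G j)] (hG : Monotone G)
          (hcov' : ∀ x : E', ∃ j, x ∈ G j) (f : E →+* E'),
          ∃ T : protoAdeleClassGroup G hG →ₜ+ protoAdeleClassGroup F hF,
            (∀ (i : ι) (j : κ) (h : ∀ x ∈ F i, f x ∈ G j) (s : protoAdeleClassGroup G hG),
              protoProj F hF i (T s) =
                adeleClassTrace (f.restrict (F i) (G j) h) (protoProj G hG j s)) ∧
            ∀ α : E, protoCharMap G hG hcov' (f α) = (protoCharMap F hF hcov α).comp T) ∧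
        Function.Injective
          (fun χ : CharGroup (protoTorus F hF) => χ.comp (protoToTorus F hF)) ∧
        (∀ α : E, (∃ χ : CharGroup (protoTorus F hF),
            χ.comp (protoToTorus F hF) = protoCharMap F hF hcov α) ↔
          α ∈ limitInverseDifferent E) ∧
        (∃ j : 𝓞 E →+ CharGroup (protoTorus F hF),
          Function.Injective j ∧
          (∀ a : 𝓞 E, (j a).comp (protoToTorus F hF) = protoCharMap F hF hcov (a : E)) ∧
          (∀ a b : 𝓞 E, (j (a * b)).comp (protoToTorus F hF) =
            otimes ((j a).comp (protoToTorus F hF)) ((j b).comp (protoToTorus F hF))) ∧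
          ∀ χ, otimes ((j 1).comp (protoToTorus F hF)) χ = χ)) := by
  refine ⟨fun K _ _ => numberField_characters K, fun E _ ι _ _ F _ hF hcov => ?_⟩
  obtain ⟨otimes, hmul⟩ := exists_transported_mul _ (protoCharMap_bijective F hF hcov)
  have hinj := comp_injective_of_surjective (protoToTorus_surjective F hF)
  refine ⟨otimes, makesField_of_bijective _ (protoCharMap_bijective F hF hcov)
    (protoCharMap_add F hF hcov) _ hmul, protoCharMap_bijective F hF hcov,
    protoCharMap_add F hF hcov, hmul, protoCharMap_coe F hF hcov,
    fun E' _ κ _ _ G _ hG hcov' f => exists_protoTrace F hF hcov G hG hcov' f, hinj,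
    exists_comp_protoToTorus_eq_iff F hF hcov, ?_⟩
  exact exists_integer_embedding _ (protoCharMap_bijective F hF hcov) (protoCharMap_add F hF hcov)
    _ hmul _ hinj (fun _ _ => rfl) fun a => (exists_comp_protoToTorus_eq_iff F hF hcov _).2
      (coe_mem_limitInverseDifferent F hcov a)
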